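/- Let $x_1,x_2,\dots$ be free variables and put $x_{i\to j}=\prod_{r=i}^{j-1}x_r$ for $i<j$. Let $\overline{\mathbb H}^{\mathrm{symb}}$ be the free commutative $\mathbb Q$-algebra generated by the following symbols, where $d\ge 1$, $n_1,\dots,n_d\ge 1$ and $1\le i_1<\dots<i_{d+1}$ are integers: - $[x_i]_0$ for $i\geq 1$, in weight $1$; - the regular symbols $[x_{i_1\to i_2},\dots,x_{i_d\to i_{d+1}}]_{n_1,\dots,n_d}$, in weight $n_1+\dots+n_d$; - the inverted symbols $[x_{i_d\to i_{d+1}}^{-1},\dots,x_{i_1\to i_2}^{-1}]_{n_d,\dots,n_1}$, in weight $n_1+\dots+n_d$. Put $[x_{i\to j}]_0=-[x_{i\to j}^{-1}]_0=\sum_{r=i}^{j-1}[x_r]_0$, and for a sequence $(y_1,\dots,y_d)$ as in a regular or an inverted symbol let $$[y_1,\dots,y_d|t_1,\dots,t_d]=\sum_{n_1,\dots,n_d\ge1}[y_1,\dots,y_d]_{n_1,\dots,n_d}\,t_1^{n_1-1}\cdots t_d^{n_d-1},\qquad [\emptyset|\emptyset]=1,\qquad y_{i\to j}=\prod_{r=i}^{j-1}y_r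 .$$ Let $\Delta\colon\overline{\mathbb H}^{\mathrm{symb}}\to\overline{\mathbb H}^{\mathrm{symb}}\otimes_{\mathbb Q}\overline{\mathbb H}^{\mathrm{symb}}$ be the algebra homomorphism with $\Delta([x_i]_0)=[x_i]_0\otimes1+1\otimes[x_i]_0$ and, for every regular or inverted sequence $(y_1,\dots,y_d)$, $$\begin{aligned}\Delta([y_1,\dots,y_d|t_1,\dots,t_d])=\sum\;&[y_{i_1\to i_2},\dots,y_{i_k\to i_{k+1}}|t_{j_1},\dots,t_{j_k}]\otimes[y_1,\dots,y_{i_1-1}|t_1,\dots,t_{i_1-1}]\\ &\prod_{\alpha=1}^{k}(-1)^{j_\alpha-i_\alpha}\exp\big([y_{i_\alpha\to i_{\alpha+1}}]_0\,t_{j_\alpha}\big)\,[y_{j_\alpha-1}^{-1},\dots,y_{i_\alpha}^{-1}|t_{j_\alpha}-t_{j_\alpha-1},\dots,t_{j_\alpha}-t_{i_\alpha}]\\ &\qquad[y_{j_\alpha+1},\dots,y_{i_{\alpha+1}-1}|t_{j_\alpha+1}-t_{j_\alpha},\dots,t_{i_{\alpha+1}-1}-t_{j_\alpha}],\end{aligned}$$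 where the sum is over all $k\ge0$ and all integers $1\le i_1\le j_1<i_2\le j_2<\dots<i_k\le j_k<i_{k+1}=d+1$. Theorem. The coproduct $\Delta$ is coassociative. Together with the counit that projects onto the weight $0$ part $\mathbb Q$, it makes $\overline{\mathbb H}^{\mathrm{symb}}$ a connected Hopf algebra over $\mathbb Q$, graded by the weight (product, coproduct, unit, counit and antipode respect the weight). -/

import Mathlib

open scoped TensorProduct

namespace SymbPolylog

/-- A polylogarithm symbol of depth `d ≥ 1`, regular or inverted, encoded by its sequence of
endpoints `p 0, …, p d` and its indices `n 0, …, n (d - 1)`.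
For `a < b` the pair `a, b` of consecutive endpoints stands for the entry
`x_{a → b} = x_a x_{a+1} ⋯ x_{b-1}`; for `b < a` it stands for `x_{b → a}⁻¹`. Thus

* `p` strictly increasing, `p = (i_1, …, i_{d+1})`: the regular symbol
  `[x_{i_1 → i_2}, …, x_{i_d → i_{d+1}}]_{n_1, …, n_d}`;
* `p` strictly decreasing, `p = (i_{d+1}, …, i_1)`: the inverted symbol
  `[x_{i_d → i_{d+1}}⁻¹, …, x_{i_1 → i_2}⁻¹]_{n_d, …, n_1}`. -/
structure PolySymbol where
  depth : ℕ
  depth_pos : 0 < depth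
  pt : Fin (depth + 1) → ℕ+
  monotone : StrictMono pt ∨ StrictAnti pt
  idx : Fin depth → ℕ+

/-- The free generators: `[x_i]_0` for `i ≥ 1`, and the regular and inverted symbols. -/
inductive Gen where
  | log (i : ℕ+) : Gen
  | poly (s : PolySymbol) : Gen

/-- The weight of a generator: `[x_i]_0` has weight `1`, and a symbol with indices
`n_1, …, n_d` has weight `n_1 + ⋯ + n_d`. -/
def Gen.weight : Gen → ℕ
  | .log _ => 1
  | .poly s => ∑ r, (s.idx r : ℕ)

/-- The free commutative `ℚ`-algebra on the generators. -/
abbrev HBar : Type := MvPolynomial Gen ℚ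

/-- The grading of `HBar` by weight: `wt n` is the weight `n` part. -/
noncomputable abbrev wt : ℕ → Submodule ℚ HBar :=
  MvPolynomial.weightedHomogeneousSubmodule ℚ Gen.weight

/-- The weight `n` part of `HBar ⊗ HBar`, i.e. the sum of the (images of) `wt a ⊗ wt b` over
`a + b = n`. -/
noncomputable def wtTensor (n : ℕ) : Submodule ℚ (HBar ⊗[ℚ] HBar) :=
  ⨆ ab ∈ Finset.HasAntidiagonal.antidiagonal n,
    LinearMap.range (TensorProduct.map (wt ab.1).subtype (wt ab.2).subtype)

/-- `[x_{a → b}]_0`, extended additively: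
`[x_{a → b}]_0 = ∑_{a ≤ r < b} [x_r]_0` if `a ≤ b`, and
`[x_{b → a}⁻¹]_0 = - ∑_{b ≤ r < a} [x_r]_0` if `b ≤ a`. -/
noncomputable def logSymbol (a b : ℕ+) : HBar :=
  ∑ r ∈ Finset.Ico a b, MvPolynomial.X (Gen.log r) -
    ∑ r ∈ Finset.Ico b a, MvPolynomial.X (Gen.log r)

open Classical in
/-- The element of `HBar` given by endpoints `p 0, …, p k` and indices `n 0, …, n (k - 1)`. It is
`1` for `k = 0`, the empty symbol. (Endpoints that are not strictly monotone do not
occur below; they get the value `0`.) -/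
noncomputable def bracket {k : ℕ} (p : Fin (k + 1) → ℕ+) (n : Fin k → ℕ+) : HBar :=
  if hk : k = 0 then 1
  else if hp : StrictMono p ∨ StrictAnti p then
    MvPolynomial.X (Gen.poly ⟨k, Nat.pos_of_ne_zero hk, p, hp, n⟩)
  else 0

/-- Power series in the variables `t 0, t 1, t 2, …`. -/
abbrev Ser (A : Type) : Type := MvPowerSeries ℕ A

/-- The variable `t i`. -/
noncomputable abbrev tVar (i : ℕ) : Ser HBar := MvPowerSeries.X i

/-- The generating series `[y_1, …, y_k | T_1, …, T_k]` in `k` formal variables,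
`∑_{n_i ≥ 1} [y_1, …, y_k]_{n_1, …, n_k} T_1^{n_1 - 1} ⋯ T_k^{n_k - 1}`, where `y` is given by its
endpoints `p`: the coefficient at the exponent `m` has the indices `m_i + 1`. -/
noncomputable def formalSeries {k : ℕ} (p : Fin (k + 1) → ℕ+) : MvPowerSeries (Fin k) HBar :=
  fun m => bracket p fun r => (m r).succPNat

/-- The generating series `[y_1, …, y_k | s_1, …, s_k]`, where the `s_i` are power series without
constant term, substituted for the formal variables. -/
noncomputable def genSeries {k : ℕ} (p : Fin (k + 1) → ℕ+) (s : Fin k → Ser HBar) : Ser HBar :=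
  MvPowerSeries.subst s (formalSeries p)

/-- The series `exp (a s)` for `a` in `HBar` and a power series `s` without constant term. -/
noncomputable def expSeries (a : HBar) (s : Ser HBar) : Ser HBar :=
  (PowerSeries.exp ℚ).subst (MvPowerSeries.C a * s)

/-- The outer product `L ⊗ R` of two power series with coefficients in `HBar`, a power series with
coefficients in `HBar ⊗ HBar`. -/
noncomputable def tensorSeries (L R : Ser HBar) : Ser (HBar ⊗[ℚ] HBar) :=
  MvPowerSeries.map (Algebra.TensorProduct.includeLeft : HBar →ₐ[ℚ] HBar ⊗[ℚ] HBar).toRingHom L *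
    MvPowerSeries.map
      (Algebra.TensorProduct.includeRight : HBar →ₐ[ℚ] HBar ⊗[ℚ] HBar).toRingHom R

/-- The sequence `i 0, i 1, …, i (k - 1), d, d, …`. -/
def upper {d k : ℕ} (i : Fin k → Fin d) (m : ℕ) : ℕ :=
  if h : m < k then i ⟨m, h⟩ else d

/-- The right-hand factor contributed by one block with data `a ≤ b < c` (`a`, `b`, `c` being
`i_α`, `j_α`, `i_{α+1}`). With `y_m` the entry with endpoints `p m, p (m + 1)` it is
`(-1)^{b - a} exp([y_{a → c}]_0 t_b) [y_{b-1}⁻¹, …, y_a⁻¹ | t_b - t_{b-1}, …, t_b - t_a]`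
`[y_{b+1}, …, y_{c-1} | t_{b+1} - t_b, …, t_{c-1} - t_b]`. -/
noncomputable def block (p : ℕ → ℕ+) (a b c : ℕ) : Ser HBar :=
  (-1) ^ (b - a) * expSeries (logSymbol (p a) (p c)) (tVar b) *
    genSeries (k := b - a) (fun r => p (b - (r : ℕ)))
      (fun r => tVar b - tVar (b - 1 - (r : ℕ))) *
    genSeries (k := c - 1 - b) (fun r => p (b + 1 + (r : ℕ)))
      (fun r => tVar (b + 1 + (r : ℕ)) - tVar b)

/-- The term of the coproduct formula indexed by `i_1 ≤ j_1 < i_2 ≤ j_2 < ⋯ < i_k ≤ j_k < i_{k+1} = d`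
(entries and variables are numbered from `0` to `d - 1`):
`[y_{i_1 → i_2}, …, y_{i_k → i_{k+1}} | t_{j_1}, …, t_{j_k}] ⊗`
`[y_0, …, y_{i_1 - 1} | t_0, …, t_{i_1 - 1}] ∏_α block(i_α, j_α, i_{α+1})`. -/
noncomputable def coproductTerm (p : ℕ → ℕ+) {d k : ℕ} (i j : Fin k → Fin d) :
    Ser (HBar ⊗[ℚ] HBar) :=
  tensorSeries
    (genSeries (k := k) (fun r => p (upper i (r : ℕ))) (fun r => tVar (j r : ℕ)))
    (genSeries (k := upper i 0) (fun r => p (r : ℕ)) (fun r => tVar (r : ℕ)) *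
      ∏ α : Fin k, block p (i α : ℕ) (j α : ℕ) (upper i ((α : ℕ) + 1)))

open Classical in
/-- The pairs of sequences `i_1 ≤ j_1 < i_2 ≤ j_2 < ⋯ < i_k ≤ j_k < d`. -/
noncomputable def interleaved (d k : ℕ) : Finset ((Fin k → Fin d) × (Fin k → Fin d)) :=
  Finset.univ.filter fun ij =>
    (∀ α, ij.1 α ≤ ij.2 α) ∧ ∀ α β, α < β → ij.2 α < ij.1 β

/-- The series `Δ [y_0, …, y_{d-1} | t_0, …, t_{d-1}]`, where `y_m` has endpoints
`p m, p (m + 1)`. -/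
noncomputable def coproductSeries (p : ℕ → ℕ+) (d : ℕ) : Ser (HBar ⊗[ℚ] HBar) :=
  ∑ k ∈ Finset.range (d + 1), ∑ ij ∈ interleaved d k, coproductTerm p ij.1 ij.2

/-- The coproduct on generators: `[x_i]_0` is primitive, and the coproduct of `[y]_{n}` is the
coefficient of `∏ t_r ^ (n_r - 1)` in the generating series. -/
noncomputable def comulGen : Gen → HBar ⊗[ℚ] HBar
  | .log i => MvPolynomial.X (Gen.log i) ⊗ₜ 1 + 1 ⊗ₜ MvPolynomial.X (Gen.log i)
  | .poly s =>
      MvPowerSeries.coeff (∑ r : Fin s.depth, Finsupp.single (r : ℕ) ((s.idx r : ℕ) - 1))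
        (coproductSeries (fun m => s.pt (Fin.ofNat (s.depth + 1) m)) s.depth)

/-- Goncharov's coproduct, extended multiplicatively from the generators. -/
noncomputable def comul : HBar →ₐ[ℚ] HBar ⊗[ℚ] HBar :=
  MvPolynomial.aeval comulGen

/-- The counit: the projection onto weight zero, which kills all generators. -/
noncomputable def counit : HBar →ₐ[ℚ] ℚ :=
  MvPolynomial.aeval fun _ => 0

end SymbPolylog

/-! Coassociativity is tested on characters. For algebra maps `f`, `g` from `HBar` to a commutative
`ℚ`-algebra, `convolve f g` is the coproduct followed by `f` and `g` on the two factors.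
Coassociativity is the associativity of `convolve` for the three inclusions into the triple tensor
product. A character is determined by its values on the `[x_i]_0` and on the generating series
(`algHom_ext_of_G`), so an identity of power series remains.

A generating series is treated as a function `G` on words with letters `(y, t)`. The indices `i_α ≤
j_α` of the coproduct formula amount to cutting the word into a prefix and a sequence of blocks with
one marked letter each: `i_α` is where a block starts and `j_α` is its mark. Each block merges to
one letter, the product of its entries with the argument of its mark. In this language the formula
is `coprodForm`, and associativity is `coprodForm_coprodForm`. Iterating the formula groups
consecutive blocks into larger marked blocks, while convolving the right-hand factors first applies
the formula inside the series attached to each block.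

The two agree because of `blockCoeff_conv`: the coefficient of a block for a convolution is the sum
over all refinements of the block into smaller blocks, the one that contains the mark being marked.
The formula inside a block is applied to shifted and to inverted words; this produces exponentials
that cancel against the exponential of the block, and signs that recombine. `chainForm_chainForm`
passes from one block to a sequence by induction on the length, and then the prefix is added. About
`G` only `G [] = 1` is used; about the exponentials, that they are additive in both arguments and
compatible with inversion.

The letters take their entries in a free monoid with involution (`Edges`), so that products always
exist. The translation to actual symbols is valid on strictly monotone words, a class that is closed
under all operations in the formula.

For the grading, the coefficients at monomials of degree `e` in a series of depth `d` have weight `e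
+ d`, and every term of the formula respects this. All generators have positive weight, so the
bialgebra is connected, and the identity is inverted under convolution by the geometric series in `1
- id`, which is finite on each weight. -/

namespace SymbPolylog

/-! ### Combinatorics of cutting words into marked blocks -/

section Words

variable {X Z : Type*}

/-- A nonempty word with a marked letter: the letters before it, the letter, the letters after. -/
abbrev Block (X : Type*) : Type _ := List X × X × List X

/-- The word underlying a marked word. -/
def Block.word (b : Block X) : List X := b.1 ++ b.2.1 :: b.2.2

/-- The concatenation of a sequence of marked words. -/
def chainWord (c : List (Block X)) : List X := c.flatMap Block.word

@[simp] lemma chainWord_nil : chainWord ([] : List (Block X)) = [] := rfl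

@[simp] lemma chainWord_cons (b : Block X) (c : List (Block X)) :
    chainWord (b :: c) = b.word ++ chainWord c := rfl

@[simp] lemma chainWord_append (c c' : List (Block X)) :
    chainWord (c ++ c') = chainWord c ++ chainWord c' := by
  simp [chainWord]

lemma Block.word_ne_nil (b : Block X) : b.word ≠ [] := by simp [Block.word]

lemma finite_splits (w : List X) : {x : List X × List X | x.1 ++ x.2 = w}.Finite := by
  refine ((Set.finite_Iic w.length).image fun n => (w.take n, w.drop n)).subset ?_
  rintro ⟨u, v⟩ rfl
  exact ⟨u.length, by simp, by simp⟩

/-- The ways to write a word as a concatenation of two words. -/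
noncomputable def splits (w : List X) : Finset (List X × List X) := (finite_splits w).toFinset

@[simp] lemma mem_splits {w : List X} {x : List X × List X} : x ∈ splits w ↔ x.1 ++ x.2 = w := by
  simp [splits]

lemma finite_marks (w : List X) : {b : Block X | b.word = w}.Finite := by
  have h : ∀ x : List X × List X,
      {b : Block X | b.1 = x.1 ∧ b.2.1 :: b.2.2 = x.2}.Finite := by
    rintro ⟨u, _ | ⟨y, v⟩⟩
    · simp
    · refine (Set.finite_singleton (u, y, v)).subset ?_
      rintro ⟨u', y', v'⟩ h
      simp at h ⊢
      tauto
  refine ((finite_splits w).biUnion fun x _ => h x).subset ?_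
  rintro ⟨u, y, v⟩ rfl
  simp [Block.word]

/-- The ways to mark a letter of a word. -/
noncomputable def marks (w : List X) : Finset (Block X) := (finite_marks w).toFinset

@[simp] lemma mem_marks {w : List X} {b : Block X} : b ∈ marks w ↔ b.word = w := by
  simp [marks]

/-- Blocks are nonempty, so removing the first block shortens the word and induction on the length
applies. -/
lemma finite_chains (w : List X) : {c : List (Block X) | chainWord c = w}.Finite := by
  induction hn : w.length using Nat.strong_induction_on generalizing w with
  | _ n ih =>
    have h : ∀ x ∈ {x : List X × List X | x.1 ++ x.2 = w},
        {c : List (Block X) | ∃ b c', c = b :: c' ∧ b.word = x.1 ∧ chainWord c' = x.2}.Finite := by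
      rintro ⟨u, v⟩ (rfl : u ++ v = w)
      by_cases hu : u = []
      · refine Set.finite_empty.subset ?_
        rintro _ ⟨b, c', rfl, hb, -⟩
        exact b.word_ne_nil (hb.trans hu)
      · have hlt : v.length < n := by
          have := List.length_pos_iff.2 hu
          simp at hn
          omega
        refine ((finite_marks u).image2 List.cons (ih _ hlt v rfl)).subset ?_
        rintro _ ⟨b, c', rfl, hb, hc⟩
        exact ⟨b, hb, c', hc, rfl⟩
    refine ((Set.finite_singleton []).union ((finite_splits w).biUnion h)).subset ?_
    rintro (_ | ⟨b, c⟩) hc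
    · simp
    · right
      simp only [Set.mem_iUnion]
      exact ⟨(b.word, chainWord c), hc, b, c, rfl, rfl, rfl⟩

/-- The ways to cut a word into nonempty words with a marked letter each. -/
noncomputable def chains (w : List X) : Finset (List (Block X)) := (finite_chains w).toFinset

@[simp] lemma mem_chains {w : List X} {c : List (Block X)} : c ∈ chains w ↔ chainWord c = w := by
  simp [chains]

lemma chainWord_eq_nil {c : List (Block X)} : chainWord c = [] ↔ c = [] := by
  cases c with
  | nil => simp
  | cons b c => simp [b.word_ne_nil]

variable {A : Type*} [AddCommMonoid A]

/-- Meant for the letter maps `merge`, `shiftLetter` and `starLetter`. No injectivity is needed,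
since a cut is determined by lengths. For `merge` it turns cuts of the merged word into cuts of the
list of blocks. -/
lemma sum_splits_map (m : X → Z) (w : List X) (K : List Z → List Z → A) :
    ∑ x ∈ splits (w.map m), K x.1 x.2 = ∑ x ∈ splits w, K (x.1.map m) (x.2.map m) := by
  symm
  refine Finset.sum_nbij (fun x => (x.1.map m, x.2.map m)) ?_ ?_ ?_ ?_
  · rintro ⟨u, v⟩ h
    simp at h ⊢
    simp [← h]
  · rintro ⟨u, v⟩ h ⟨u', v'⟩ h' he
    simp at h h' he
    have := congrArg List.length he.1
    simp at this
    simpa using List.append_inj (h.trans h'.symm) this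
  · rintro ⟨u, v⟩ h
    simp at h
    obtain ⟨a, b, rfl, rfl, rfl⟩ := List.append_eq_map_iff.1 h
    exact ⟨(a, b), by simp⟩
  · simp

lemma sum_marks_map (m : X → Z) (w : List X) (K : Block Z → A) :
    ∑ b ∈ marks (w.map m), K b = ∑ b ∈ marks w, K (b.1.map m, m b.2.1, b.2.2.map m) := by
  symm
  refine Finset.sum_nbij (fun b => (b.1.map m, m b.2.1, b.2.2.map m)) ?_ ?_ ?_ ?_
  · rintro ⟨u, y, v⟩ h
    simp [Block.word] at h ⊢
    simp [← h]
  · rintro ⟨u, y, v⟩ h ⟨u', y', v'⟩ h' he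
    simp [Block.word] at h h' he
    have := congrArg List.length he.1
    simp at this
    simpa using List.append_inj (h.trans h'.symm) this
  · rintro ⟨u, y, v⟩ h
    simp [Block.word] at h
    obtain ⟨a, b, rfl, rfl, h2⟩ := List.append_eq_map_iff.1 h
    obtain ⟨y', v', rfl, rfl, rfl⟩ := List.map_eq_cons_iff.1 h2
    exact ⟨(a, y', v'), by simp [Block.word]⟩
  · simp

lemma sum_splits_assoc (w : List X) (K : List X → List X → List X → A) :
    ∑ x ∈ splits w, ∑ z ∈ splits x.2, K x.1 z.1 z.2 =
      ∑ x ∈ splits w, ∑ z ∈ splits x.1, K z.1 z.2 x.2 := by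
  rw [Finset.sum_sigma', Finset.sum_sigma']
  refine Finset.sum_nbij' (fun q => ⟨(q.1.1 ++ q.2.1, q.2.2), (q.1.1, q.2.1)⟩)
    (fun q => ⟨(q.2.1, q.2.2 ++ q.1.2), (q.2.2, q.1.2)⟩) ?_ ?_ ?_ ?_ ?_
  all_goals
    rintro ⟨⟨u, v⟩, ⟨u', v'⟩⟩ h
    simp at h ⊢
  all_goals
    obtain ⟨rfl, rfl⟩ := h
    simp

/-- A cut between two blocks of a chain is a cut of the underlying word, with each half cut into
blocks separately. -/
lemma sum_chains_splits (w : List X) (K : List (Block X) → List (Block X) → A) :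
    ∑ c ∈ chains w, ∑ x ∈ splits c, K x.1 x.2 =
      ∑ x ∈ splits w, ∑ c ∈ chains x.1, ∑ c' ∈ chains x.2, K c c' := by
  simp_rw [← Finset.sum_product']
  rw [Finset.sum_sigma', Finset.sum_sigma']
  refine Finset.sum_nbij' (fun q => ⟨(chainWord q.2.1, chainWord q.2.2), (q.2.1, q.2.2)⟩)
    (fun q => ⟨q.2.1 ++ q.2.2, (q.2.1, q.2.2)⟩) ?_ ?_ ?_ ?_ ?_
  · rintro ⟨c, ⟨u', v'⟩⟩ h
    simp at h ⊢
    obtain ⟨rfl, rfl⟩ := h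
    simp
  · rintro ⟨⟨u, v⟩, ⟨c, c'⟩⟩ h
    simp at h ⊢
    obtain ⟨rfl, rfl, rfl⟩ := h
    simp
  · rintro ⟨c, ⟨u', v'⟩⟩ h
    simp at h ⊢
    obtain ⟨rfl, rfl⟩ := h
    simp
  · rintro ⟨⟨u, v⟩, ⟨c, c'⟩⟩ h
    simp at h ⊢
    obtain ⟨rfl, rfl, rfl⟩ := h
    simp
  · simp

/-- Peels off the first block; this drives the induction in `chainForm_chainForm`. -/
lemma sum_chains_cons (w : List X) (K : List (Block X) → A) :
    ∑ c ∈ chains w, K c = (if w = [] then K [] else 0) +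
      ∑ x ∈ splits w, ∑ b ∈ marks x.1, ∑ c ∈ chains x.2, K (b :: c) := by
  classical
  rw [← Finset.sum_filter_add_sum_filter_not (chains w) (fun c => c = [])]
  congr 1
  · by_cases hw : w = []
    · subst hw
      rw [if_pos rfl, Finset.sum_eq_single_of_mem []]
      · simp
      · intro b hb h
        simp at hb
        exact absurd hb.2 h
    · rw [if_neg hw]
      refine Finset.sum_eq_zero fun c hc => ?_
      simp at hc
      obtain ⟨h, rfl⟩ := hc
      exact absurd h.symm hw
  · simp_rw [← Finset.sum_product']
    rw [Finset.sum_sigma']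
    symm
    refine Finset.sum_nbij (fun q => q.2.1 :: q.2.2) ?_ ?_ ?_ ?_
    · rintro ⟨⟨u, v⟩, ⟨b, c⟩⟩ h
      simp at h ⊢
      obtain ⟨rfl, rfl, rfl⟩ := h
      rfl
    · rintro ⟨⟨u, v⟩, ⟨b, c⟩⟩ h ⟨⟨u', v'⟩, ⟨b', c'⟩⟩ h' he
      simp at h h' he ⊢
      obtain ⟨-, rfl, rfl⟩ := h
      obtain ⟨-, rfl, rfl⟩ := h'
      obtain ⟨rfl, rfl⟩ := he
      simp
    · rintro (_ | ⟨b, c⟩) h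
      · simp at h
      · simp at h
        exact ⟨⟨(b.word, chainWord c), (b, c)⟩, by simpa using h, rfl⟩
    · simp

lemma sum_splits_reverse (w : List X) (K : List X → List X → A) :
    ∑ x ∈ splits w.reverse, K x.1 x.2 = ∑ x ∈ splits w, K x.2.reverse x.1.reverse := by
  refine Finset.sum_nbij' (fun x => (x.2.reverse, x.1.reverse))
    (fun x => (x.2.reverse, x.1.reverse)) ?_ ?_ ?_ ?_ ?_
  · rintro ⟨u, v⟩ h
    simp at h ⊢
    simp [← List.reverse_append, h]
  · rintro ⟨u, v⟩ h
    simp at h ⊢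
    simp [← List.reverse_append, h]
  all_goals simp

/-- The image of a marked word under a map of letters. -/
def Block.map (m : X → Z) (b : Block X) : Block Z := (b.1.map m, m b.2.1, b.2.2.map m)

/-- The reversed marked word. -/
def Block.reverse (b : Block X) : Block X := (b.2.2.reverse, b.2.1, b.1.reverse)

lemma Block.word_map (m : X → Z) (b : Block X) : (b.map m).word = b.word.map m := by
  simp [Block.map, Block.word]

lemma Block.word_reverse (b : Block X) : b.reverse.word = b.word.reverse := by
  simp [Block.reverse, Block.word]

@[simp] lemma Block.reverse_reverse (b : Block X) : b.reverse.reverse = b := by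
  simp [Block.reverse]

lemma chainWord_map (m : X → Z) (c : List (Block X)) :
    chainWord (c.map (Block.map m)) = (chainWord c).map m := by
  induction c with
  | nil => rfl
  | cons b c ih => simp [ih, Block.word_map]

lemma chainWord_reverse (c : List (Block X)) :
    chainWord (c.map Block.reverse).reverse = (chainWord c).reverse := by
  induction c with
  | nil => rfl
  | cons b c ih => simp [ih, Block.word_reverse]

lemma sum_chains_reverse (w : List X) (K : List (Block X) → A) :
    ∑ c ∈ chains w.reverse, K c = ∑ c ∈ chains w, K (c.map Block.reverse).reverse := by
  have key : ∀ c : List (Block X), ((c.map Block.reverse).reverse.map Block.reverse).reverse = c := by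
    intro c
    simp [Function.comp_def]
  refine Finset.sum_nbij' (fun c => (c.map Block.reverse).reverse)
    (fun c => (c.map Block.reverse).reverse) ?_ ?_ ?_ ?_ ?_
  · intro c h
    exact mem_chains.2 (by rw [chainWord_reverse, mem_chains.1 h, List.reverse_reverse])
  · intro c h
    exact mem_chains.2 (by rw [chainWord_reverse, mem_chains.1 h])
  · intro c _
    exact key c
  · intro c _
    exact key c
  · intro c _
    rw [key c]

lemma Block.word_eq_map (m : X → Z) {b : Block Z} {w : List X} (h : b.word = w.map m) :
    ∃ b' : Block X, b'.word = w ∧ b'.map m = b := by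
  obtain ⟨u, y, v⟩ := b
  obtain ⟨u', v', rfl, rfl, h2⟩ := List.append_eq_map_iff.1 h
  obtain ⟨y', v', rfl, rfl, rfl⟩ := List.map_eq_cons_iff.1 h2
  exact ⟨(u', y', v'), rfl, rfl⟩

lemma chainWord_eq_map (m : X → Z) {c : List (Block Z)} {w : List X}
    (h : chainWord c = w.map m) :
    ∃ c' : List (Block X), chainWord c' = w ∧ c'.map (Block.map m) = c := by
  induction c generalizing w with
  | nil =>
    have : w = [] := by simpa using h.symm
    exact ⟨[], by simp [this]⟩
  | cons b c ih =>
    obtain ⟨u', v', rfl, h1, h2⟩ := List.append_eq_map_iff.1 h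
    obtain ⟨b', rfl, rfl⟩ := Block.word_eq_map m h1.symm
    obtain ⟨c', rfl, rfl⟩ := ih h2.symm
    exact ⟨b' :: c', rfl, rfl⟩

/-- The images fix the lengths and the common word fixes the letters, so `m` may be non-injective.
The remainders `r`, `r'` allow the use on the first block of a longer chain. -/
lemma Block.eq_of_map_eq (m : X → Z) {b b' : Block X} {r r' : List X}
    (h : b.map m = b'.map m) (hw : b.word ++ r = b'.word ++ r') : b = b' := by
  obtain ⟨u, y, v⟩ := b
  obtain ⟨u', y', v'⟩ := b'
  simp only [Block.map, Prod.mk.injEq] at h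
  simp only [Block.word] at hw
  have h1 := congrArg List.length h.1
  have h2 := congrArg List.length h.2.2
  rw [List.length_map, List.length_map] at h1 h2
  simp only [List.append_assoc, List.cons_append] at hw
  obtain ⟨rfl, hw1⟩ := List.append_inj hw h1
  obtain ⟨rfl, hw2⟩ := List.cons.inj hw1
  obtain ⟨rfl, -⟩ := List.append_inj hw2 h2
  rfl

lemma eq_of_map_blockMap_eq (m : X → Z) {c c' : List (Block X)}
    (h : c.map (Block.map m) = c'.map (Block.map m)) (hw : chainWord c = chainWord c') :
    c = c' := by
  induction c generalizing c' with
  | nil =>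
    simpa using h.symm
  | cons b c ih =>
    cases c' with
    | nil => simp at h
    | cons b' c' =>
      simp only [List.map_cons, List.cons.injEq] at h
      obtain rfl := Block.eq_of_map_eq m h.1 hw
      rw [ih h.2 (by simpa using hw)]

lemma sum_chains_map (m : X → Z) (w : List X) (K : List (Block Z) → A) :
    ∑ c ∈ chains (w.map m), K c = ∑ c ∈ chains w, K (c.map (Block.map m)) := by
  symm
  refine Finset.sum_nbij (fun c => c.map (Block.map m)) ?_ ?_ ?_ ?_
  · intro c h
    simp at h ⊢
    rw [chainWord_map, h]
  · intro c h c' h' he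
    simp at h h'
    exact eq_of_map_blockMap_eq m he (h.trans h'.symm)
  · intro c h
    simp at h
    obtain ⟨c', h1, h2⟩ := chainWord_eq_map m h
    exact ⟨c', by simpa using h1, h2⟩
  · simp

/-- A marked sequence of marked words gives a marked word. -/
def joinBlock (D : Block (Block X)) : Block X :=
  (chainWord D.1 ++ D.2.1.1, D.2.1.2.1, D.2.1.2.2 ++ chainWord D.2.2)

lemma word_joinBlock (D : Block (Block X)) : (joinBlock D).word = chainWord D.word := by
  obtain ⟨a, ⟨z, y, z'⟩, e⟩ := D
  simp [joinBlock, Block.word]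

/-- The ways to cut a word into a word followed by a sequence of marked words, as a sum. -/
noncomputable def sumTail (w : List X) (K : List X → List (Block X) → A) : A :=
  ∑ x ∈ splits w, ∑ c ∈ chains x.2, K x.1 c

/-- The ways to cut a word into a sequence of marked words followed by a word, as a sum. -/
noncomputable def sumInit (w : List X) (K : List (Block X) → List X → A) : A :=
  ∑ x ∈ splits w, ∑ c ∈ chains x.1, K c x.2

/-- The combinatorial heart of coassociativity. The mark of the marked block marks a letter of `w`.
Conversely, once that letter is fixed, the letters before it form a chain followed by the left part
`z` of the marked block, and the letters after it form the right part `z'` followed by a chain. -/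
lemma sum_chains_marks (w : List X) (K : Block (Block X) → A) :
    ∑ c ∈ chains w, ∑ D ∈ marks c, K D =
      ∑ b ∈ marks w, sumInit b.1 fun a z => sumTail b.2.2 fun z' e => K (a, (z, b.2.1, z'), e) := by
  simp_rw [sumInit, sumTail, Finset.sum_sigma']
  refine Finset.sum_nbij'
    (fun q => ⟨joinBlock q.2, (chainWord q.2.1, q.2.2.1.1), q.2.1,
      (q.2.2.1.2.2, chainWord q.2.2.2), q.2.2.2⟩)
    (fun q => ⟨q.2.2.1 ++ (q.2.1.2, q.1.2.1, q.2.2.2.1.1) :: q.2.2.2.2,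
      (q.2.2.1, (q.2.1.2, q.1.2.1, q.2.2.2.1.1), q.2.2.2.2)⟩) ?_ ?_ ?_ ?_ ?_
  · rintro ⟨c, ⟨a, ⟨z, y, z'⟩, e⟩⟩ h
    simp [Block.word, joinBlock] at h ⊢
    obtain ⟨rfl, rfl⟩ := h
    simp [Block.word]
  · rintro ⟨⟨u, y, v⟩, ⟨cw, z⟩, a, ⟨z', ew⟩, e⟩ h
    simp [Block.word] at h ⊢
    obtain ⟨rfl, rfl, rfl, rfl, rfl⟩ := h
    simp
  · rintro ⟨c, ⟨a, ⟨z, y, z'⟩, e⟩⟩ h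
    simp [Block.word] at h
    obtain ⟨rfl, rfl⟩ := h
    rfl
  · rintro ⟨⟨u, y, v⟩, ⟨cw, z⟩, a, ⟨z', ew⟩, e⟩ h
    simp [Block.word] at h
    obtain ⟨rfl, rfl, rfl, rfl, rfl⟩ := h
    rfl
  · rintro ⟨c, ⟨a, ⟨z, y, z'⟩, e⟩⟩ h
    rfl

end Words

/-! ### The coproduct formula on words and its coassociativity -/

section Data

set_option linter.unusedSectionVars false

variable {Y S A : Type*} [Monoid Y] [StarMul Y] [AddCommGroup S] [CommRing A]

/-- The values of the generating series at words in `Y × S`, and of the exponentials. -/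
structure Coeffs (Y S A : Type*) [Monoid Y] [StarMul Y] [AddCommGroup S] [CommRing A] where
  G : List (Y × S) → A
  E : Y → S → A
  G_nil : G [] = 1
  E_one : ∀ s, E 1 s = 1
  E_mul : ∀ y z s, E (y * z) s = E y s * E z s
  E_zero : ∀ y, E y 0 = 1
  E_add : ∀ y s t, E y (s + t) = E y s * E y t
  E_star : ∀ y s, E (star y) s = E y (-s)

/-- The product of the entries of a word. -/
def prodY (w : List (Y × S)) : Y := (w.map Prod.fst).prod

@[simp] lemma prodY_nil : prodY ([] : List (Y × S)) = 1 := rfl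

@[simp] lemma prodY_cons (x : Y × S) (w : List (Y × S)) : prodY (x :: w) = x.1 * prodY w := by
  simp [prodY]

@[simp] lemma prodY_append (u v : List (Y × S)) : prodY (u ++ v) = prodY u * prodY v := by
  simp [prodY]

/-- Subtraction of `t` from the second component of a letter. -/
def shiftLetter (t : S) (x : Y × S) : Y × S := (x.1, x.2 - t)

/-- Inversion of a letter. -/
def starLetter (t : S) (x : Y × S) : Y × S := (star x.1, t - x.2)

/-- The word with the arguments shifted by `t`. -/
def shift (t : S) (w : List (Y × S)) : List (Y × S) := w.map (shiftLetter t)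

/-- The reversed word with inverted entries. -/
def rev (t : S) (w : List (Y × S)) : List (Y × S) := (w.map (starLetter t)).reverse

/-- The letter that a marked word contributes to the left factor of the coproduct. -/
def merge (b : Block (Y × S)) : Y × S := (prodY b.word, b.2.1.2)

/-- The right factor of the coproduct contributed by a marked word. -/
def blockCoeff (h : Coeffs Y S A) (b : Block (Y × S)) : A :=
  (-1) ^ b.1.length * h.E (prodY b.word) b.2.1.2 * h.G (rev b.2.1.2 b.1) *
    h.G (shift b.2.1.2 b.2.2)

/-- The product of the factors contributed by a sequence of marked words. -/
def chainCoeff (h : Coeffs Y S A) (c : List (Block (Y × S))) : A := (c.map (blockCoeff h)).prod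

@[simp] lemma chainCoeff_nil (h : Coeffs Y S A) : chainCoeff h [] = 1 := rfl

@[simp] lemma chainCoeff_cons (h : Coeffs Y S A) (b : Block (Y × S)) (c : List (Block (Y × S))) :
    chainCoeff h (b :: c) = blockCoeff h b * chainCoeff h c := by
  simp [chainCoeff]

@[simp] lemma chainCoeff_append (h : Coeffs Y S A) (c c' : List (Block (Y × S))) :
    chainCoeff h (c ++ c') = chainCoeff h c * chainCoeff h c' := by
  simp [chainCoeff]

/-- The coproduct formula. -/
noncomputable def coprodForm (F : List (Y × S) → A) (h : Coeffs Y S A) (w : List (Y × S)) : A :=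
  sumTail w fun u c => h.G u * chainCoeff h c * F (c.map merge)

/-- The part of the coproduct formula without prefix. -/
noncomputable def chainForm (F : List (Y × S) → A) (h : Coeffs Y S A) (w : List (Y × S)) : A :=
  ∑ c ∈ chains w, chainCoeff h c * F (c.map merge)

lemma coprodForm_eq (F : List (Y × S) → A) (h : Coeffs Y S A) (w : List (Y × S)) :
    coprodForm F h w = ∑ x ∈ splits w, h.G x.1 * chainForm F h x.2 := by
  simp [coprodForm, chainForm, sumTail, Finset.mul_sum, mul_assoc]

/-- The convolution product of two families of values. -/
noncomputable def Coeffs.conv (g h : Coeffs Y S A) : Coeffs Y S A where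
  G := coprodForm g.G h
  E y s := g.E y s * h.E y s
  G_nil := by
    have h1 : splits ([] : List (Y × S)) = {([], [])} := by ext ⟨a, b⟩; simp
    have h2 : chains ([] : List (Y × S)) = {[]} := by ext c; simp [chainWord_eq_nil]
    simp [coprodForm, sumTail, h1, h2, g.G_nil, h.G_nil]
  E_one s := by simp [g.E_one, h.E_one]
  E_mul y z s := by rw [g.E_mul, h.E_mul]; ring
  E_zero s := by simp [g.E_zero, h.E_zero]
  E_add y s t := by rw [g.E_add, h.E_add]; ring
  E_star y s := by rw [g.E_star, h.E_star]

lemma prodY_shift (t : S) (w : List (Y × S)) : prodY (shift t w) = prodY w := by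
  simp [prodY, shift, shiftLetter, Function.comp_def]

lemma prodY_rev (t : S) (w : List (Y × S)) : prodY (rev t w) = star (prodY w) := by
  induction w with
  | nil => simp [rev]
  | cons x w ih =>
    have : rev t (x :: w) = rev t w ++ [starLetter t x] := by simp [rev]
    simp [this, ih, starLetter]

@[simp] lemma length_rev (t : S) (v : List (Y × S)) : (rev t v).length = v.length := by
  simp [rev]

@[simp] lemma length_shift (t : S) (v : List (Y × S)) : (shift t v).length = v.length := by
  simp [shift]

/-- In this and the next three lemmas, `shift` and `rev` act on arguments as `x ↦ x - t` and `x ↦ t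
- x`, and both inversion and reversal are involutions, so these maps compose like reflections and
translations of a line. -/
lemma rev_rev (s t : S) (v : List (Y × S)) : rev (s - t) (rev s v) = shift t v := by
  simp [rev, shift, shiftLetter, starLetter, Function.comp_def]

lemma shift_rev (s t : S) (v : List (Y × S)) : shift (s - t) (rev s v) = rev t v := by
  simp [rev, shift, shiftLetter, starLetter, Function.comp_def]

lemma rev_shift (s t : S) (v : List (Y × S)) : rev (t - s) (shift s v) = rev t v := by
  simp [rev, shift, shiftLetter, starLetter, Function.comp_def]

lemma shift_shift (s t : S) (v : List (Y × S)) : shift (t - s) (shift s v) = shift t v := by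
  simp [shift, shiftLetter, Function.comp_def]

/-- The sequence of marked words with shifted arguments. -/
def shiftChain (t : S) (c : List (Block (Y × S))) : List (Block (Y × S)) :=
  c.map (Block.map (shiftLetter t))

/-- The reversed sequence of marked words with inverted entries. -/
def revChain (t : S) (c : List (Block (Y × S))) : List (Block (Y × S)) :=
  ((c.map (Block.map (starLetter t))).map Block.reverse).reverse

lemma merge_shift (t : S) (c : List (Block (Y × S))) :
    (shiftChain t c).map merge = shift t (c.map merge) := by
  simp only [shiftChain, shift, List.map_map]
  refine List.map_congr_left fun b _ => ?_
  simp only [Function.comp, merge, Block.word_map]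
  rw [← shift, prodY_shift]
  rfl

lemma merge_rev (t : S) (c : List (Block (Y × S))) :
    (revChain t c).map merge = rev t (c.map merge) := by
  simp only [revChain, rev, List.map_map, ← List.map_reverse]
  refine List.map_congr_left fun b _ => ?_
  simp only [Function.comp, merge, Block.word_map, Block.word_reverse]
  rw [← rev, prodY_rev]
  rfl

/-- The two `G` factors involve only differences of arguments, so only the exponential sees the
shift. -/
lemma blockCoeff_shift (h : Coeffs Y S A) (t : S) (b : Block (Y × S)) :
    blockCoeff h (b.map (shiftLetter t)) = h.E (prodY b.word) (-t) * blockCoeff h b := by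
  obtain ⟨u, y, v⟩ := b
  have h1 : prodY (Block.map (shiftLetter t) (u, y, v)).word = prodY (Block.word (u, y, v)) := by
    rw [Block.word_map, ← shift, prodY_shift]
  simp only [blockCoeff, h1]
  simp only [Block.map, shiftLetter, List.length_map]
  change _ * _ * h.G (rev (y.2 - t) (shift t u)) * h.G (shift (y.2 - t) (shift t v)) = _
  rw [rev_shift, shift_shift, sub_eq_add_neg, h.E_add]
  ring

/-- Inversion interchanges the two `G` factors of a block. The sign changes from `(-1) ^ u.length`
to `(-1) ^ v.length`, and the block has `u.length + v.length + 1` letters, which explains the extra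
minus. -/
lemma blockCoeff_rev (h : Coeffs Y S A) (t : S) (b : Block (Y × S)) :
    blockCoeff h (b.map (starLetter t)).reverse =
      -(-1) ^ b.word.length * h.E (prodY b.word) (-t) * blockCoeff h b := by
  obtain ⟨u, y, v⟩ := b
  have h1 : prodY (Block.map (starLetter t) (u, y, v)).reverse.word =
      star (prodY (Block.word (u, y, v))) := by
    rw [Block.word_reverse, Block.word_map, ← rev, prodY_rev]
  simp only [blockCoeff, h1]
  simp only [Block.map, Block.reverse, starLetter, List.length_map, List.length_reverse]
  change _ * _ * h.G (rev (t - y.2) (rev t v)) * h.G (shift (t - y.2) (rev t u)) = _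
  rw [rev_rev, shift_rev, h.E_star, neg_sub, sub_eq_add_neg, h.E_add]
  have h2 : (Block.word (u, y, v)).length = u.length + v.length + 1 := by
    simp [Block.word]; omega
  have h3 : (-1 : A) ^ u.length * (-1) ^ u.length = 1 := by
    rw [← mul_pow]; simp
  rw [h2, pow_succ, pow_add]
  linear_combination (-h.G (rev y.2 u) * h.G (shift y.2 v) * (-1) ^ v.length *
    h.E (prodY (Block.word (u, y, v))) y.2 * h.E (prodY (Block.word (u, y, v))) (-t)) * h3

lemma chainCoeff_shift (h : Coeffs Y S A) (t : S) (c : List (Block (Y × S))) :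
    chainCoeff h (shiftChain t c) = h.E (prodY (chainWord c)) (-t) * chainCoeff h c := by
  induction c with
  | nil => simp [shiftChain, h.E_one]
  | cons b c ih =>
    have : shiftChain t (b :: c) = b.map (shiftLetter t) :: shiftChain t c := rfl
    simp [this, ih, blockCoeff_shift, h.E_mul]
    ring

lemma chainCoeff_rev (h : Coeffs Y S A) (t : S) (c : List (Block (Y × S))) :
    chainCoeff h (revChain t c) = (-1) ^ c.length * (-1) ^ (chainWord c).length *
      h.E (prodY (chainWord c)) (-t) * chainCoeff h c := by
  induction c with
  | nil => simp [revChain, h.E_one]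
  | cons b c ih =>
    have : revChain t (b :: c) = revChain t c ++ [(b.map (starLetter t)).reverse] := by
      simp [revChain]
    simp [this, ih, blockCoeff_rev, h.E_mul, pow_add]
    ring

lemma coprodForm_shift (F : List (Y × S) → A) (h : Coeffs Y S A) (t : S) (w : List (Y × S)) :
    coprodForm F h (shift t w) = sumTail w fun z e =>
      h.G (shift t z) * (h.E (prodY (chainWord e)) (-t) * chainCoeff h e) *
        F (shift t (e.map merge)) := by
  unfold coprodForm sumTail
  rw [shift, sum_splits_map (shiftLetter t) w fun u v =>
    ∑ c ∈ chains v, h.G u * chainCoeff h c * F (c.map merge)]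
  refine Finset.sum_congr rfl fun x _ => ?_
  rw [sum_chains_map (shiftLetter t) x.2 fun c =>
    h.G (x.1.map (shiftLetter t)) * chainCoeff h c * F (c.map merge)]
  refine Finset.sum_congr rfl fun e _ => ?_
  dsimp only
  rw [← chainCoeff_shift, ← merge_shift]
  rfl

/-- Reversal moves the prefix of the formula to the end of `w`, hence `sumInit` in place of
`sumTail`. -/
lemma coprodForm_rev (F : List (Y × S) → A) (h : Coeffs Y S A) (t : S) (w : List (Y × S)) :
    coprodForm F h (rev t w) = sumInit w fun a z =>
      h.G (rev t z) * ((-1) ^ a.length * (-1) ^ (chainWord a).length *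
        h.E (prodY (chainWord a)) (-t) * chainCoeff h a) * F (rev t (a.map merge)) := by
  unfold coprodForm sumTail sumInit
  rw [rev, sum_splits_reverse (w.map (starLetter t)) fun u v =>
    ∑ c ∈ chains v, h.G u * chainCoeff h c * F (c.map merge),
    sum_splits_map (starLetter t) w fun u v =>
    ∑ c ∈ chains u.reverse, h.G v.reverse * chainCoeff h c * F (c.map merge)]
  refine Finset.sum_congr rfl fun x _ => ?_
  rw [sum_chains_reverse (x.1.map (starLetter t)) fun c =>
    h.G (x.2.map (starLetter t)).reverse * chainCoeff h c * F (c.map merge),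
    sum_chains_map (starLetter t) x.1 fun c =>
    h.G (x.2.map (starLetter t)).reverse * chainCoeff h (c.map Block.reverse).reverse *
      F ((c.map Block.reverse).reverse.map merge)]
  refine Finset.sum_congr rfl fun e _ => ?_
  dsimp only
  rw [← chainCoeff_rev, ← merge_rev]
  rfl

lemma prodY_map_merge (c : List (Block (Y × S))) : prodY (c.map merge) = prodY (chainWord c) := by
  induction c with
  | nil => rfl
  | cons b c ih => simp [ih, merge]

/-- Merging in two stages is merging at once: the surviving argument is that of the marked letter of
the marked block. -/
lemma merge_map_merge (D : Block (Block (Y × S))) :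
    merge (D.map merge) = merge (joinBlock D) := by
  have h : prodY (D.map merge).word = prodY (joinBlock D).word := by
    rw [word_joinBlock, Block.word_map, prodY_map_merge]
  simp only [merge, h]
  rfl

lemma Coeffs.E_mul_E_neg (h : Coeffs Y S A) (y : Y) (s : S) : h.E y s * h.E y (-s) = 1 := by
  rw [← h.E_add, add_neg_cancel, h.E_zero]

/-- Expand the two convolved `G` factors by `coprodForm_rev` and `coprodForm_shift`. The outer
chains `a` and `e` bring factors `h.E _ (-y.2)`, which reduce the exponential of the whole block to
that of the middle block `(z, y, z')`. The signs reduce to `(-1) ^ z.length` for the middle block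
and `(-1) ^ a.length` for the merged block. -/
lemma blockCoeff_conv (g h : Coeffs Y S A) (b : Block (Y × S)) :
    blockCoeff (g.conv h) b = sumInit b.1 fun a z => sumTail b.2.2 fun z' e =>
      chainCoeff h (a ++ (z, b.2.1, z') :: e) *
        blockCoeff g (Block.map merge (a, (z, b.2.1, z'), e)) := by
  obtain ⟨u, y, v⟩ := b
  have h0 : blockCoeff (g.conv h) (u, y, v) = coprodForm g.G h (rev y.2 u) *
      ((-1) ^ u.length * (g.E (prodY (Block.word (u, y, v))) y.2 *
        h.E (prodY (Block.word (u, y, v))) y.2) * coprodForm g.G h (shift y.2 v)) := by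
    simp only [blockCoeff, Coeffs.conv]
    ring
  rw [h0, coprodForm_rev, coprodForm_shift]
  unfold sumInit sumTail
  rw [Finset.sum_mul]
  refine Finset.sum_congr rfl fun x hx => ?_
  rw [Finset.sum_mul]
  refine Finset.sum_congr rfl fun a ha => ?_
  rw [Finset.mul_sum, Finset.mul_sum]
  refine Finset.sum_congr rfl fun x' hx' => ?_
  rw [Finset.mul_sum, Finset.mul_sum]
  refine Finset.sum_congr rfl fun e he => ?_
  obtain ⟨ca, z⟩ := x
  obtain ⟨z', ce⟩ := x'
  simp only [mem_splits, mem_chains] at hx ha hx' he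
  subst ha he hx hx'
  have h1 : prodY (Block.word (a.map merge, (prodY (Block.word (z, y, z')), y.2), e.map merge)) =
      prodY (chainWord a) * prodY (Block.word (z, y, z')) * prodY (chainWord e) := by
    change prodY (Block.map merge (a, (z, y, z'), e)).word = _
    rw [Block.word_map, prodY_map_merge]
    simp [Block.word, mul_assoc]
  have h2 : prodY (Block.word (chainWord a ++ z, y, z' ++ chainWord e)) =
      prodY (chainWord a) * prodY (Block.word (z, y, z')) * prodY (chainWord e) := by
    simp [Block.word, mul_assoc]
  -- The three cancellations: the exponentials over `a`, those over `e`, and the sign of the letters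
  -- of `a`.
  have h3 := h.E_mul_E_neg (prodY (chainWord a)) y.2
  have h4 := h.E_mul_E_neg (prodY (chainWord e)) y.2
  have h5 : (-1 : A) ^ (chainWord a).length * (-1) ^ (chainWord a).length = 1 := by
    rw [← mul_pow]; simp
  simp only [blockCoeff, h1, h2, chainCoeff_append, chainCoeff_cons, h.E_mul, Block.map, merge,
    List.length_append, List.length_map, pow_add]
  generalize g.E _ y.2 = q
  generalize g.G (rev _ _) = q'
  generalize g.G (shift _ _) = q''
  generalize chainCoeff h a = ra
  generalize chainCoeff h e = re
  generalize h.E (prodY (Block.word _)) y.2 = rb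
  generalize h.G _ = r1
  generalize h.G _ = r2
  generalize (-1 : A) ^ z.length = z1
  generalize (-1 : A) ^ a.length = a1
  linear_combination (r1 * r2 * q * q' * q'' * ra * re * rb * z1 * a1) *
    (h3 * h.E (prodY (chainWord e)) y.2 * h.E (prodY (chainWord e)) (-y.2) *
      (-1 : A) ^ (chainWord a).length * (-1) ^ (chainWord a).length +
        h4 * (-1 : A) ^ (chainWord a).length * (-1) ^ (chainWord a).length + h5)

/-- The first merged letter is absorbed into `F`, so inductions based on this must let `F` vary. -/
lemma chainForm_eq (F : List (Y × S) → A) (h : Coeffs Y S A) (w : List (Y × S)) :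
    chainForm F h w = (if w = [] then F [] else 0) + ∑ x ∈ splits w, ∑ b ∈ marks x.1,
      blockCoeff h b * chainForm (fun v => F (merge b :: v)) h x.2 := by
  rw [chainForm, sum_chains_cons w fun c => chainCoeff h c * F (c.map merge)]
  simp [chainForm, Finset.mul_sum, mul_assoc]

/-- The second cutting groups the blocks of the first into runs with one marked block. Summing over
all subdivisions of the first run gives `blockCoeff (g.conv h)` by `blockCoeff_conv`; the rest of
the word is handled by induction on the length. -/
lemma chainForm_chainForm (F : List (Y × S) → A) (g h : Coeffs Y S A) (w : List (Y × S)) :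
    chainForm (chainForm F g) h w = chainForm F (g.conv h) w := by
  induction hn : w.length using Nat.strong_induction_on generalizing w F with
  | _ n ih =>
    have e1 : chainForm (chainForm F g) h w = (if w = [] then F [] else 0) +
        ∑ c ∈ chains w, ∑ x ∈ splits c, ∑ D ∈ marks x.1,
          chainCoeff h x.1 * blockCoeff g (D.map merge) * (chainCoeff h x.2 *
            chainForm (fun v => F (merge (joinBlock D) :: v)) g (x.2.map merge)) := by
      -- Peel off the first block of the merged word. It comes from a run `D` of blocks of `w`,
      -- which joins to the single marked word `joinBlock D`.
      have : ∀ c : List (Block (Y × S)), chainCoeff h c * chainForm F g (c.map merge) =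
          (if c = [] then F [] else 0) + ∑ x ∈ splits c, ∑ D ∈ marks x.1,
          chainCoeff h x.1 * blockCoeff g (D.map merge) * (chainCoeff h x.2 *
            chainForm (fun v => F (merge (joinBlock D) :: v)) g (x.2.map merge)) := by
        intro c
        rw [chainForm_eq, sum_splits_map merge c fun u v => ∑ b ∈ marks u,
          blockCoeff g b * chainForm (fun v => F (merge b :: v)) g v, mul_add]
        congr 1
        · by_cases hc : c = [] <;> simp [hc]
        · rw [Finset.mul_sum]
          refine Finset.sum_congr rfl fun x hx => ?_
          rw [sum_marks_map merge x.1 fun b =>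
            blockCoeff g b * chainForm (fun v => F (merge b :: v)) g (x.2.map merge),
            Finset.mul_sum]
          refine Finset.sum_congr rfl fun D _ => ?_
          obtain rfl := mem_splits.1 hx
          change _ * (blockCoeff g (D.map merge) *
            chainForm (fun v => F (merge (D.map merge) :: v)) g _) = _
          rw [merge_map_merge, chainCoeff_append]
          ring
      rw [chainForm]
      simp_rw [this]
      rw [Finset.sum_add_distrib]
      congr 1
      by_cases hw : w = []
      · subst hw
        have h2 : chains ([] : List (Y × S)) = {[]} := by ext c; simp [chainWord_eq_nil]
        simp [h2]
      · rw [if_neg hw]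
        refine Finset.sum_eq_zero fun c hc => ?_
        rw [if_neg]
        rintro rfl
        exact hw (mem_chains.1 hc).symm
    rw [e1, chainForm_eq F (g.conv h), sum_chains_splits w fun c c' => ∑ D ∈ marks c,
      chainCoeff h c * blockCoeff g (D.map merge) * (chainCoeff h c' *
            chainForm (fun v => F (merge (joinBlock D) :: v)) g (c'.map merge))]
    congr 1
    refine Finset.sum_congr rfl fun x hx => ?_
    -- The run `D` has a nonempty underlying word, so `x.2` is shorter than `w` and the induction
    -- hypothesis evaluates the sum over its chains.
    have e2 : ∀ c ∈ chains x.1, ∑ c' ∈ chains x.2, ∑ D ∈ marks c,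
        chainCoeff h c * blockCoeff g (D.map merge) * (chainCoeff h c' *
            chainForm (fun v => F (merge (joinBlock D) :: v)) g (c'.map merge)) =
        ∑ D ∈ marks c, chainCoeff h D.word * blockCoeff g (D.map merge) *
          chainForm (fun v => F (merge (joinBlock D) :: v)) (g.conv h) x.2 := by
      intro c hc
      rw [Finset.sum_comm]
      refine Finset.sum_congr rfl fun D hD => ?_
      have hlt : x.2.length < n := by
        obtain rfl := mem_marks.1 hD
        have h1 := (joinBlock D).word_ne_nil
        rw [word_joinBlock, mem_chains.1 hc] at h1
        have := List.length_pos_iff.2 h1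
        have h3 := congrArg List.length (mem_splits.1 hx)
        simp at h3
        omega
      rw [← ih _ hlt _ _ rfl, mem_marks.1 hD, ← Finset.mul_sum]
      rfl
    rw [Finset.sum_congr rfl e2, sum_chains_marks x.1 fun D =>
      chainCoeff h D.word * blockCoeff g (D.map merge) *
          chainForm (fun v => F (merge (joinBlock D) :: v)) (g.conv h) x.2]
    refine Finset.sum_congr rfl fun b hb => ?_
    rw [blockCoeff_conv]
    unfold sumInit sumTail
    simp only [Finset.sum_mul]
    refine Finset.sum_congr rfl fun y hy => Finset.sum_congr rfl fun a ha =>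
      Finset.sum_congr rfl fun y' hy' => Finset.sum_congr rfl fun e he => ?_
    have hj : joinBlock (a, (y.2, b.2.1, y'.1), e) = b := by
      simp only [joinBlock, mem_chains.1 ha, mem_chains.1 he, mem_splits.1 hy, mem_splits.1 hy']
    rw [hj]
    rfl

/-- The coproduct formula is coassociative. -/
theorem coprodForm_coprodForm (F : List (Y × S) → A) (g h : Coeffs Y S A) (w : List (Y × S)) :
    coprodForm (coprodForm F g) h w = coprodForm F (g.conv h) w := by
  -- The prefix of the merged word consists of the first blocks, those over `z.1`. The blocks over
  -- `z.2` are cut twice without prefix, so `chainForm_chainForm` applies to them.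
  have e1 : coprodForm (coprodForm F g) h w = ∑ x ∈ splits w, ∑ z ∈ splits x.2,
      ∑ c ∈ chains z.1, h.G x.1 * (chainCoeff h c * g.G (c.map merge)) *
        chainForm F (g.conv h) z.2 := by
    rw [coprodForm_eq]
    refine Finset.sum_congr rfl fun x _ => ?_
    have : ∀ c : List (Block (Y × S)), chainCoeff h c * coprodForm F g (c.map merge) =
        ∑ z ∈ splits c, chainCoeff h z.1 * g.G (z.1.map merge) *
          (chainCoeff h z.2 * chainForm F g (z.2.map merge)) := by
      intro c
      rw [coprodForm_eq, sum_splits_map merge c fun u v => g.G u * chainForm F g v,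
        Finset.mul_sum]
      refine Finset.sum_congr rfl fun z hz => ?_
      obtain rfl := mem_splits.1 hz
      rw [chainCoeff_append]
      ring
    rw [chainForm, Finset.sum_congr rfl fun c _ => this c,
      sum_chains_splits x.2 fun c c' => chainCoeff h c * g.G (c.map merge) *
          (chainCoeff h c' * chainForm F g (c'.map merge)), Finset.mul_sum]
    refine Finset.sum_congr rfl fun z _ => ?_
    rw [Finset.mul_sum]
    refine Finset.sum_congr rfl fun c _ => ?_
    rw [← Finset.mul_sum, ← chainForm_chainForm, chainForm]
    ring
  -- The prefix of `w` and the blocks over which the second prefix lies form one prefix; the sum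
  -- over its cuttings is the `G` of `g.conv h`.
  rw [e1, sum_splits_assoc w fun u v v' => ∑ c ∈ chains v,
    h.G u * (chainCoeff h c * g.G (c.map merge)) * chainForm F (g.conv h) v', coprodForm_eq]
  refine Finset.sum_congr rfl fun x _ => ?_
  simp only [Coeffs.conv]
  rw [coprodForm, sumTail, Finset.sum_mul]
  refine Finset.sum_congr rfl fun z _ => ?_
  rw [Finset.sum_mul]
  refine Finset.sum_congr rfl fun c _ => ?_
  ring

end Data

/-! ### Exponentials, evaluated series and the coproduct with arbitrary arguments -/

section Series

set_option linter.unusedSectionVars false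

variable {R : Type} [CommRing R] [Algebra ℚ R] {τ υ : Type}

lemma hasSubst_of_constantCoeff {x : MvPowerSeries τ R} (hx : x.constantCoeff = 0) :
    PowerSeries.HasSubst x := PowerSeries.HasSubst.of_constantCoeff_zero hx

lemma exp_subst_eq {x : MvPowerSeries τ R} (hx : x.constantCoeff = 0) :
    (PowerSeries.exp ℚ).subst x = (PowerSeries.exp R).subst x := by
  ext e
  rw [PowerSeries.coeff_subst (hasSubst_of_constantCoeff hx),
    PowerSeries.coeff_subst (hasSubst_of_constantCoeff hx)]
  refine finsum_congr fun d => ?_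
  simp [PowerSeries.coeff_exp, Algebra.smul_def]

/-- The universal case of the functional equation: comparing coefficients leaves the factorial
formula for binomial coefficients. -/
lemma exp_subst_X_add_X :
    (PowerSeries.exp R).subst (MvPowerSeries.X 0 + MvPowerSeries.X 1 : MvPowerSeries (Fin 2) R) =
      (PowerSeries.exp R).subst (MvPowerSeries.X 0 : MvPowerSeries (Fin 2) R) *
        (PowerSeries.exp R).subst (MvPowerSeries.X 1 : MvPowerSeries (Fin 2) R) := by
  ext e
  rw [PowerSeries.coeff_subst_X_zero_add_X_one, PowerSeries.coeff_subst_X_zero_subst_mul_X_one]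
  simp only [PowerSeries.coeff_exp]
  rw [← map_natCast (algebraMap ℚ R), ← map_mul, ← map_mul]
  congr 1
  rw [Nat.cast_add_choose]
  have := Nat.factorial_ne_zero (e 0)
  have := Nat.factorial_ne_zero (e 1)
  have := Nat.factorial_ne_zero (e 0 + e 1)
  field_simp

lemma exp_subst_add {x y : MvPowerSeries τ R} (hx : x.constantCoeff = 0)
    (hy : y.constantCoeff = 0) :
    (PowerSeries.exp R).subst (x + y) =
      (PowerSeries.exp R).subst x * (PowerSeries.exp R).subst y := by
  have ha : MvPowerSeries.HasSubst (![x, y] : Fin 2 → MvPowerSeries τ R) :=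
    MvPowerSeries.hasSubst_of_constantCoeff_zero (by simp [Fin.forall_fin_two, hx, hy])
  have h := congrArg (MvPowerSeries.subst ![x, y]) (exp_subst_X_add_X (R := R))
  have h0 : PowerSeries.HasSubst (MvPowerSeries.X 0 : MvPowerSeries (Fin 2) R) :=
    hasSubst_of_constantCoeff (by simp)
  have h1 : PowerSeries.HasSubst (MvPowerSeries.X 1 : MvPowerSeries (Fin 2) R) :=
    hasSubst_of_constantCoeff (by simp)
  have h2 : PowerSeries.HasSubst
      (MvPowerSeries.X 0 + MvPowerSeries.X 1 : MvPowerSeries (Fin 2) R) :=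
    hasSubst_of_constantCoeff (by simp)
  rw [MvPowerSeries.subst_mul ha] at h
  simp only [PowerSeries.subst_def] at h ⊢
  rw [MvPowerSeries.subst_comp_subst_apply h0.const ha,
    MvPowerSeries.subst_comp_subst_apply h1.const ha,
    MvPowerSeries.subst_comp_subst_apply h2.const ha] at h
  simpa [MvPowerSeries.subst_add ha, MvPowerSeries.subst_X ha] using h

lemma exp_subst_zero : (PowerSeries.exp R).subst (0 : MvPowerSeries τ R) = 1 := by
  rw [PowerSeries.subst_zero_eq_C_constantCoeff]
  simp

/-- The series `exp (f a * s)`. -/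
noncomputable def evalExp (f : HBar →ₐ[ℚ] R) (a : HBar) (s : MvPowerSeries τ R) :
    MvPowerSeries τ R :=
  (PowerSeries.exp R).subst (MvPowerSeries.C (f a) * s)

lemma evalExp_add_left (f : HBar →ₐ[ℚ] R) (a b : HBar) {s : MvPowerSeries τ R}
    (hs : s.constantCoeff = 0) : evalExp f (a + b) s = evalExp f a s * evalExp f b s := by
  rw [evalExp, evalExp, evalExp, ← exp_subst_add (by simp [hs]) (by simp [hs]), map_add, map_add,
    add_mul]

lemma evalExp_add_right (f : HBar →ₐ[ℚ] R) (a : HBar) {s t : MvPowerSeries τ R}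
    (hs : s.constantCoeff = 0) (ht : t.constantCoeff = 0) :
    evalExp f a (s + t) = evalExp f a s * evalExp f a t := by
  rw [evalExp, evalExp, evalExp, ← exp_subst_add (by simp [hs]) (by simp [ht]), mul_add]

lemma evalExp_zero_left (f : HBar →ₐ[ℚ] R) (s : MvPowerSeries τ R) : evalExp f 0 s = 1 := by
  simp [evalExp, exp_subst_zero]

lemma evalExp_zero_right (f : HBar →ₐ[ℚ] R) (a : HBar) :
    evalExp f a (0 : MvPowerSeries τ R) = 1 := by
  simp [evalExp, exp_subst_zero]

lemma evalExp_neg (f : HBar →ₐ[ℚ] R) (a : HBar) (s : MvPowerSeries τ R) :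
    evalExp f (-a) s = evalExp f a (-s) := by
  simp [evalExp]

lemma subst_evalExp (f : HBar →ₐ[ℚ] R) (a : HBar) {s : MvPowerSeries τ R}
    (hs : s.constantCoeff = 0) {σ : τ → MvPowerSeries υ R} (hσ : MvPowerSeries.HasSubst σ) :
    MvPowerSeries.subst σ (evalExp f a s) = evalExp f a (MvPowerSeries.subst σ s) := by
  have h : PowerSeries.HasSubst (MvPowerSeries.C (f a) * s) :=
    hasSubst_of_constantCoeff (by simp [hs])
  rw [evalExp, evalExp, PowerSeries.subst_def, MvPowerSeries.subst_comp_subst_apply h.const hσ,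
    PowerSeries.subst_def, MvPowerSeries.subst_mul hσ, MvPowerSeries.subst_C]

lemma map_expSeries (f : HBar →ₐ[ℚ] R) (a : HBar) {s : Ser HBar} (hs : s.constantCoeff = 0) :
    MvPowerSeries.map f.toRingHom (expSeries a s) =
      evalExp f a (MvPowerSeries.map f.toRingHom s) := by
  have h : PowerSeries.HasSubst (MvPowerSeries.C a * s) :=
    hasSubst_of_constantCoeff (by simp [hs])
  rw [expSeries, exp_subst_eq (by simp [hs]), PowerSeries.map_subst h, evalExp]
  simp

/-- The image under `f` of the generating series of a symbol, with `s` substituted for the formal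
variables. -/
noncomputable def evalSeries (f : HBar →ₐ[ℚ] R) {k : ℕ} (p : Fin (k + 1) → ℕ+)
    (s : Fin k → MvPowerSeries τ R) : MvPowerSeries τ R :=
  MvPowerSeries.subst s (MvPowerSeries.map f.toRingHom (formalSeries p))

lemma evalSeries_congr (f : HBar →ₐ[ℚ] R) {k k' : ℕ} (h : k = k') {p : Fin (k + 1) → ℕ+}
    {p' : Fin (k' + 1) → ℕ+} {s : Fin k → MvPowerSeries τ R} {s' : Fin k' → MvPowerSeries τ R}
    (hp : ∀ r (h1 : r < k + 1) (h2 : r < k' + 1), p ⟨r, h1⟩ = p' ⟨r, h2⟩)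
    (hs : ∀ r (h1 : r < k) (h2 : r < k'), s ⟨r, h1⟩ = s' ⟨r, h2⟩) :
    evalSeries f p s = evalSeries f p' s' := by
  subst h
  have h1 : p = p' := funext fun r => hp r r.2 r.2
  have h2 : s = s' := funext fun r => hs r r.2 r.2
  rw [h1, h2]

lemma evalSeries_zero (f : HBar →ₐ[ℚ] R) {k : ℕ} (hk : k = 0) (p : Fin (k + 1) → ℕ+)
    (s : Fin k → MvPowerSeries τ R) : evalSeries f p s = 1 := by
  subst hk
  have h : MvPowerSeries.map f.toRingHom (formalSeries p) = MvPowerSeries.C 1 := by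
    ext m
    obtain rfl : m = 0 := Subsingleton.elim _ _
    have : MvPowerSeries.coeff 0 (formalSeries p) = 1 := by
      change formalSeries p 0 = 1
      simp [formalSeries, bracket]
    rw [MvPowerSeries.coeff_map, this]
    simp
  rw [evalSeries, h, MvPowerSeries.subst_C, map_one]

lemma subst_evalSeries (f : HBar →ₐ[ℚ] R) {k : ℕ} (p : Fin (k + 1) → ℕ+)
    {s : Fin k → MvPowerSeries τ R} (hs : ∀ r, (s r).constantCoeff = 0)
    {σ : τ → MvPowerSeries υ R} (hσ : MvPowerSeries.HasSubst σ) :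
    MvPowerSeries.subst σ (evalSeries f p s) =
      evalSeries f p fun r => MvPowerSeries.subst σ (s r) := by
  rw [evalSeries, evalSeries, MvPowerSeries.subst_comp_subst_apply
    (MvPowerSeries.hasSubst_of_constantCoeff_zero hs) hσ]

lemma map_genSeries (f : HBar →ₐ[ℚ] R) {k : ℕ} (p : Fin (k + 1) → ℕ+)
    {s : Fin k → Ser HBar} (hs : ∀ r, (s r).constantCoeff = 0) :
    MvPowerSeries.map f.toRingHom (genSeries p s) =
      evalSeries f p fun r => MvPowerSeries.map f.toRingHom (s r) := by
  rw [genSeries, evalSeries,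
    MvPowerSeries.map_subst (MvPowerSeries.hasSubst_of_constantCoeff_zero hs)]

/-- The image of `block` with other series in place of the variables. -/
noncomputable def blockEval (f : HBar →ₐ[ℚ] R) (p : ℕ → ℕ+) (s : ℕ → MvPowerSeries τ R)
    (a b c : ℕ) : MvPowerSeries τ R :=
  (-1) ^ (b - a) * evalExp f (logSymbol (p a) (p c)) (s b) *
    evalSeries f (k := b - a) (fun r => p (b - (r : ℕ))) (fun r => s b - s (b - 1 - (r : ℕ))) *
    evalSeries f (k := c - 1 - b) (fun r => p (b + 1 + (r : ℕ)))
      (fun r => s (b + 1 + (r : ℕ)) - s b)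

/-- The image of `coproductTerm` with other series in place of the variables. -/
noncomputable def termEval (f g : HBar →ₐ[ℚ] R) (p : ℕ → ℕ+) (s : ℕ → MvPowerSeries τ R) {d k : ℕ}
    (i j : Fin k → Fin d) : MvPowerSeries τ R :=
  evalSeries f (k := k) (fun r => p (upper i (r : ℕ))) (fun r => s (j r : ℕ)) *
    (evalSeries g (k := upper i 0) (fun r => p (r : ℕ)) (fun r => s (r : ℕ)) *
      ∏ α : Fin k, blockEval g p s (i α : ℕ) (j α : ℕ) (upper i ((α : ℕ) + 1)))

lemma map_block (f : HBar →ₐ[ℚ] R) (p : ℕ → ℕ+) (a b c : ℕ) :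
    MvPowerSeries.map f.toRingHom (block p a b c) = blockEval f p MvPowerSeries.X a b c := by
  rw [block, blockEval, map_mul, map_mul, map_mul, map_expSeries f _ (by simp),
    map_genSeries f _ (by simp), map_genSeries f _ (by simp)]
  simp

/-- The homomorphism `x ↦ ∑ f x' * g x''`. -/
noncomputable def convolve (f g : HBar →ₐ[ℚ] R) : HBar →ₐ[ℚ] R :=
  (Algebra.TensorProduct.productMap f g).comp comul

lemma map_coproductTerm (f g : HBar →ₐ[ℚ] R) (p : ℕ → ℕ+) {d k : ℕ} (i j : Fin k → Fin d) :
    MvPowerSeries.map (Algebra.TensorProduct.productMap f g).toRingHom (coproductTerm p i j) =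
      termEval f g p MvPowerSeries.X i j := by
  have hl : ∀ F : Ser HBar, MvPowerSeries.map (Algebra.TensorProduct.productMap f g).toRingHom
      (MvPowerSeries.map
        (Algebra.TensorProduct.includeLeft : HBar →ₐ[ℚ] HBar ⊗[ℚ] HBar).toRingHom F) =
      MvPowerSeries.map f.toRingHom F := by
    intro F
    ext e
    simp
  have hr : ∀ F : Ser HBar, MvPowerSeries.map (Algebra.TensorProduct.productMap f g).toRingHom
      (MvPowerSeries.map
        (Algebra.TensorProduct.includeRight : HBar →ₐ[ℚ] HBar ⊗[ℚ] HBar).toRingHom F) =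
      MvPowerSeries.map g.toRingHom F := by
    intro F
    ext e
    simp
  rw [coproductTerm, tensorSeries, map_mul, hl, hr, map_mul, map_prod, map_genSeries f _ (by simp),
    map_genSeries g _ (by simp)]
  simp only [map_block, termEval]
  simp

lemma subst_blockEval (f : HBar →ₐ[ℚ] R) (p : ℕ → ℕ+) {s : ℕ → MvPowerSeries τ R}
    (hs : ∀ r, (s r).constantCoeff = 0) (a b c : ℕ)
    {σ : τ → MvPowerSeries υ R} (hσ : MvPowerSeries.HasSubst σ) :
    MvPowerSeries.subst σ (blockEval f p s a b c) =
      blockEval f p (fun r => MvPowerSeries.subst σ (s r)) a b c := by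
  rw [blockEval, blockEval, MvPowerSeries.subst_mul hσ, MvPowerSeries.subst_mul hσ,
    MvPowerSeries.subst_mul hσ, subst_evalExp f _ (hs b) hσ,
    subst_evalSeries f _ (by simp [hs]) hσ, subst_evalSeries f _ (by simp [hs]) hσ]
  simp only [MvPowerSeries.subst_sub hσ]
  simp only [← MvPowerSeries.coe_substAlgHom hσ, map_pow, map_neg, map_one]

lemma subst_termEval (f g : HBar →ₐ[ℚ] R) (p : ℕ → ℕ+) {s : ℕ → MvPowerSeries τ R}
    (hs : ∀ r, (s r).constantCoeff = 0) {d k : ℕ} (i j : Fin k → Fin d)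
    {σ : τ → MvPowerSeries υ R} (hσ : MvPowerSeries.HasSubst σ) :
    MvPowerSeries.subst σ (termEval f g p s i j) =
      termEval f g p (fun r => MvPowerSeries.subst σ (s r)) i j := by
  rw [termEval, termEval, MvPowerSeries.subst_mul hσ, MvPowerSeries.subst_mul hσ,
    subst_evalSeries f _ (by simp [hs]) hσ, subst_evalSeries g _ (by simp [hs]) hσ]
  simp only [← subst_blockEval g p hs _ _ _ hσ]
  simp only [← MvPowerSeries.coe_substAlgHom hσ, map_prod]

lemma blockEval_congr (f : HBar →ₐ[ℚ] R) (p : ℕ → ℕ+) {s s' : ℕ → MvPowerSeries τ R} {a b c : ℕ}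
    (hbc : b < c) (h : ∀ r < c, s r = s' r) :
    blockEval f p s a b c = blockEval f p s' a b c := by
  rw [blockEval, blockEval, h b hbc]
  congr 1
  · congr 1
    refine evalSeries_congr f rfl (fun _ _ _ => rfl) fun r h1 _ => ?_
    rw [h _ (by simp only; omega)]
  · refine evalSeries_congr f rfl (fun _ _ _ => rfl) fun r h1 _ => ?_
    rw [h _ (by simp only; omega)]

lemma upper_le {d k : ℕ} (i : Fin k → Fin d) (m : ℕ) : upper i m ≤ d := by
  unfold upper
  split_ifs
  · exact (i _).2.le
  · exact le_rfl

lemma lt_upper_succ {d k : ℕ} {i j : Fin k → Fin d} (h : (i, j) ∈ interleaved d k) (α : Fin k) :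
    (j α : ℕ) < upper i ((α : ℕ) + 1) := by
  simp only [interleaved, Finset.mem_filter, Finset.mem_univ, true_and] at h
  unfold upper
  split_ifs with hα
  · exact h.2 α ⟨α + 1, hα⟩ (by simp [Fin.lt_def])
  · exact (j α).2

lemma termEval_congr (f g : HBar →ₐ[ℚ] R) (p : ℕ → ℕ+) {s s' : ℕ → MvPowerSeries τ R} {d k : ℕ}
    {i j : Fin k → Fin d} (hij : (i, j) ∈ interleaved d k) (h : ∀ r < d, s r = s' r) :
    termEval f g p s i j = termEval f g p s' i j := by
  rw [termEval, termEval]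
  refine congrArg₂ _ ?_ (congrArg₂ _ ?_ ?_)
  · exact evalSeries_congr f rfl (fun _ _ _ => rfl) fun r _ _ => h _ (j _).2
  · refine evalSeries_congr g rfl (fun _ _ _ => rfl) fun r h1 _ => h _ ?_
    exact h1.trans_le (upper_le i 0)
  · refine Finset.prod_congr rfl fun α _ => ?_
    have h1 := lt_upper_succ hij α
    have h2 := upper_le i (α + 1)
    generalize upper i (α + 1) = c at h1 h2 ⊢
    exact blockEval_congr g p h1 fun r hr => h r (hr.trans_le h2)

/-- The image of the series in the definition of the coproduct. -/
noncomputable def sumEval (f g : HBar →ₐ[ℚ] R) (p : ℕ → ℕ+) (s : ℕ → MvPowerSeries τ R) (d : ℕ) :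
    MvPowerSeries τ R :=
  ∑ k ∈ Finset.range (d + 1), ∑ ij ∈ interleaved d k, termEval f g p s ij.1 ij.2

lemma subst_sumEval (f g : HBar →ₐ[ℚ] R) (p : ℕ → ℕ+) {s : ℕ → MvPowerSeries τ R}
    (hs : ∀ r, (s r).constantCoeff = 0) (d : ℕ)
    {σ : τ → MvPowerSeries υ R} (hσ : MvPowerSeries.HasSubst σ) :
    MvPowerSeries.subst σ (sumEval f g p s d) =
      sumEval f g p (fun r => MvPowerSeries.subst σ (s r)) d := by
  simp only [sumEval, ← subst_termEval f g p hs _ _ hσ]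
  simp only [← MvPowerSeries.coe_substAlgHom hσ, map_sum]

lemma sumEval_congr (f g : HBar →ₐ[ℚ] R) (p : ℕ → ℕ+) {s s' : ℕ → MvPowerSeries τ R} {d : ℕ}
    (h : ∀ r < d, s r = s' r) : sumEval f g p s d = sumEval f g p s' d :=
  Finset.sum_congr rfl fun _ _ => Finset.sum_congr rfl fun _ hij => termEval_congr f g p hij h

/-- The coproduct formula with arbitrary arguments. -/
theorem evalSeries_convolve (f g : HBar →ₐ[ℚ] R) {d : ℕ} (hd : d ≠ 0) (p : Fin (d + 1) → ℕ+)
    (hp : StrictMono p ∨ StrictAnti p) {s : ℕ → MvPowerSeries τ R}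
    (hs : ∀ r, (s r).constantCoeff = 0) :
    evalSeries (convolve f g) p (fun r => s r) =
      sumEval f g (fun m => p (Fin.ofNat (d + 1) m)) s d := by
  classical
  let e : Fin d ↪ ℕ := Fin.valEmbedding
  -- The value `0` beyond `d` is harmless: the formula uses only the first `d` arguments, by
  -- `sumEval_congr`.
  let x : ℕ → MvPowerSeries (Fin d) R := fun r => if h : r < d then MvPowerSeries.X ⟨r, h⟩ else 0
  have hx : ∀ r, (x r).constantCoeff = 0 := by
    intro r
    simp only [x]
    split_ifs <;> simp
  have he : MvPowerSeries.HasSubst (fun r : Fin d => (MvPowerSeries.X (r : ℕ) : Ser R)) :=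
    MvPowerSeries.hasSubst_of_constantCoeff_zero (by simp)
  have hs' : MvPowerSeries.HasSubst (fun r : Fin d => s r) :=
    MvPowerSeries.hasSubst_of_constantCoeff_zero fun r => hs r
  let q : ℕ → ℕ+ := fun m => p (Fin.ofNat (d + 1) m)
  -- The series that defines the coproduct has infinitely many variables available but is the
  -- renaming of a series in `d` variables.
  have h1 : MvPowerSeries.map (Algebra.TensorProduct.productMap f g).toRingHom
      (coproductSeries q d) = MvPowerSeries.rename e (sumEval f g q x d) := by
    rw [MvPowerSeries.rename_eq_subst]
    change _ = MvPowerSeries.subst (fun r : Fin d => (MvPowerSeries.X (r : ℕ) : Ser R)) _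
    rw [subst_sumEval f g q hx d he, coproductSeries]
    simp only [map_sum, map_coproductTerm]
    refine sumEval_congr f g q fun r hr => ?_
    simp only [x, dif_pos hr]
    rw [MvPowerSeries.subst_X he]
  -- The coproduct of symbols is defined coefficientwise. Since renaming along an embedding
  -- preserves coefficients, this is an identity in `d` formal variables, into which any arguments
  -- can be substituted.
  have h2 : MvPowerSeries.map (convolve f g).toRingHom (formalSeries p) = sumEval f g q x d := by
    ext m
    rw [← MvPowerSeries.coeff_embDomain_rename e (sumEval f g q x d), ← h1, MvPowerSeries.coeff_map,
      MvPowerSeries.coeff_map]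
    have h3 : MvPowerSeries.coeff m (formalSeries p) = MvPolynomial.X (Gen.poly
        ⟨d, Nat.pos_of_ne_zero hd, p, hp, fun r => (m r).succPNat⟩) := by
      change formalSeries p m = _
      rw [formalSeries, bracket, dif_neg hd, dif_pos hp]
    have h4 : Finsupp.embDomain e m = ∑ r : Fin d, Finsupp.single (r : ℕ) (m r) := by
      conv_lhs => rw [← Finsupp.univ_sum_single m]
      rw [Finsupp.embDomain_eq_mapDomain, Finsupp.mapDomain_finsetSum]
      simp only [Finsupp.mapDomain_single]
      rfl
    rw [h3, h4]
    change Algebra.TensorProduct.productMap f g (comul (MvPolynomial.X _)) = _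
    rw [comul, MvPolynomial.aeval_X, comulGen]
    simp [q]
  rw [evalSeries, h2, subst_sumEval f g q hx d hs']
  refine sumEval_congr f g q fun r hr => ?_
  simp only [x, dif_pos hr]
  rw [MvPowerSeries.subst_X hs']

end Series

/-! ### Index sequences of the coproduct formula as cuttings of words -/

section Positions

variable {X : Type*}

/-- The positions of the first letters and of the marked letters in the word `u ++ chainWord c`
that starts at position `lo`. -/
def positions : ℕ → List X → List (Block X) → List (ℕ × ℕ)
  | _, _, [] => []
  | lo, u, (x, _, v) :: c =>
      (lo + u.length, lo + u.length + x.length) :: positions (lo + u.length + x.length + 1) v c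

/-- Lists of pairs `i_1 ≤ j_1 < i_2 ≤ j_2 < ⋯ < d` with `lo ≤ i_1`. -/
def Interleaves (d : ℕ) : ℕ → List (ℕ × ℕ) → Prop
  | _, [] => True
  | lo, (a, b) :: l => lo ≤ a ∧ a ≤ b ∧ b < d ∧ Interleaves d (b + 1) l

lemma interleaves_positions {d lo : ℕ} {u : List X} {c : List (Block X)}
    (h : lo + (u ++ chainWord c).length = d) : Interleaves d lo (positions lo u c) := by
  induction c generalizing lo u with
  | nil => trivial
  | cons b c ih =>
    obtain ⟨x, y, v⟩ := b
    simp only [chainWord_cons, Block.word, List.length_append, List.length_cons] at h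
    refine ⟨by omega, by omega, by omega, ih ?_⟩
    simp only [List.length_append]
    omega

lemma exists_positions_eq {d lo : ℕ} {l : List (ℕ × ℕ)} (hl : Interleaves d lo l) {w : List X}
    (hw : lo + w.length = d) :
    ∃ (u : List X) (c : List (Block X)), u ++ chainWord c = w ∧ positions lo u c = l := by
  induction l generalizing lo w with
  | nil => exact ⟨w, [], by simp, rfl⟩
  | cons ab l ih =>
    obtain ⟨a, b⟩ := ab
    obtain ⟨h1, h2, h3, h4⟩ := hl
    have hb : b - lo < w.length := by omega
    obtain ⟨v, c, hv, hp⟩ := ih (w := w.drop (b - lo + 1)) h4 (by rw [List.length_drop]; omega)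
    -- The recursion, applied to the letters after the mark, returns as its prefix `v` the letters
    -- up to the next start; these are the right part of the present block.
    refine ⟨w.take (a - lo), ((w.drop (a - lo)).take (b - a), w[b - lo], v) :: c, ?_, ?_⟩
    · simp only [chainWord_cons, Block.word, List.append_assoc, List.cons_append, hv,
        List.getElem_cons_drop]
      conv_rhs => rw [← List.take_append_drop (a - lo) w,
        ← List.take_append_drop (b - a) (w.drop (a - lo)), List.drop_drop]
      rw [show a - lo + (b - a) = b - lo by omega]
    · have e1 : lo + (w.take (a - lo)).length = a := by rw [List.length_take]; omega
      have e2 : ((w.drop (a - lo)).take (b - a)).length = b - a := by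
        rw [List.length_take, List.length_drop]; omega
      have e3 : a + (b - a) = b := by omega
      simp only [positions, e1, e2, e3, hp]

lemma positions_inj {lo : ℕ} {u u' : List X} {c c' : List (Block X)}
    (h : positions lo u c = positions lo u' c') (hw : u ++ chainWord c = u' ++ chainWord c') :
    u = u' ∧ c = c' := by
  induction c generalizing lo u u' c' with
  | nil =>
    cases c' with
    | nil => exact ⟨by simpa using hw, rfl⟩
    | cons b c' => simp [positions] at h
  | cons b c ih =>
    obtain ⟨x, y, v⟩ := b
    cases c' with
    | nil => simp [positions] at h
    | cons b' c' =>
      obtain ⟨x', y', v'⟩ := b'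
      simp only [positions, List.cons.injEq, Prod.mk.injEq] at h
      obtain ⟨⟨h1, h2⟩, h3⟩ := h
      have hu : u.length = u'.length := by omega
      have hx : x.length = x'.length := by omega
      rw [hu, hx] at h3
      simp only [chainWord_cons, Block.word, List.append_assoc, List.cons_append] at hw
      obtain ⟨rfl, hw1⟩ := List.append_inj hw hu
      obtain ⟨rfl, hw2⟩ := List.append_inj hw1 hx
      obtain ⟨rfl, hw3⟩ := List.cons.inj hw2
      obtain ⟨rfl, rfl⟩ := ih h3 hw3
      exact ⟨rfl, rfl⟩

/-- A pair of sequences as a list of pairs. -/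
def pairList {d k : ℕ} (i j : Fin k → Fin d) : List (ℕ × ℕ) :=
  List.ofFn fun α => ((i α : ℕ), (j α : ℕ))

lemma interleaves_pairList {d k lo : ℕ} {i j : Fin k → Fin d} (h0 : ∀ α, lo ≤ i α)
    (h1 : ∀ α, i α ≤ j α) (h2 : ∀ α β, α < β → j α < i β) :
    Interleaves d lo (pairList i j) := by
  induction k generalizing lo with
  | zero => simp [pairList, Interleaves]
  | succ k ih =>
    rw [pairList, List.ofFn_succ]
    refine ⟨h0 0, h1 0, (j 0).2, ih (i := fun α => i α.succ) (j := fun α => j α.succ) ?_ ?_ ?_⟩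
    · intro α
      exact h2 0 α.succ (Fin.succ_pos α)
    · exact fun α => h1 _
    · exact fun α β h => h2 _ _ (by simpa using h)

lemma exists_pairList_eq {d lo : ℕ} {l : List (ℕ × ℕ)} (hl : Interleaves d lo l) :
    ∃ (k : ℕ) (i j : Fin k → Fin d), pairList i j = l ∧ (∀ α, lo ≤ i α) ∧ (∀ α, i α ≤ j α) ∧
      ∀ α β, α < β → j α < i β := by
  induction l generalizing lo with
  | nil => exact ⟨0, Fin.elim0, Fin.elim0, by simp [pairList], by simp, by simp, by simp⟩
  | cons ab l ih =>
    obtain ⟨a, b⟩ := ab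
    obtain ⟨h1, h2, h3, h4⟩ := hl
    obtain ⟨k, i, j, rfl, g1, g2, g3⟩ := ih h4
    refine ⟨k + 1, Fin.cons ⟨a, by omega⟩ i, Fin.cons ⟨b, h3⟩ j, ?_, ?_, ?_, ?_⟩
    · rw [pairList, List.ofFn_succ]
      simp [pairList]
    · intro α
      refine Fin.cases ?_ (fun β => ?_) α
      · exact h1
      · have := g1 β
        simp only [Fin.cons_succ]
        omega
    · intro α
      refine Fin.cases ?_ (fun β => ?_) α
      · exact h2
      · exact g2 β
    · intro α β
      refine Fin.cases ?_ (fun α' => ?_) α <;> refine Fin.cases ?_ (fun β' => ?_) β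
      · simp
      · intro _
        have := g1 β'
        simp only [Fin.cons_succ, Fin.cons_zero, Fin.lt_def]
        omega
      · simp
      · intro h
        exact g3 _ _ (by simpa using h)

/-- Both index sets are in bijection with the lists satisfying `Interleaves d 0`. -/
lemma sum_interleaved_eq {A : Type*} [AddCommMonoid A] {d : ℕ} {w : List X} (hw : w.length = d)
    (Φ : List (ℕ × ℕ) → A) :
    ∑ k ∈ Finset.range (d + 1), ∑ ij ∈ interleaved d k, Φ (pairList ij.1 ij.2) =
      sumTail w fun u c => Φ (positions 0 u c) := by
  classical
  let V : Finset (List (ℕ × ℕ)) := ((Finset.range (d + 1)).sigma (interleaved d)).image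
    fun q => pairList q.2.1 q.2.2
  have hV : ∀ l, l ∈ V ↔ Interleaves d 0 l := by
    intro l
    simp only [V, Finset.mem_image, Finset.mem_sigma, interleaved, Finset.mem_filter,
      Finset.mem_univ, true_and, Finset.mem_range]
    constructor
    · rintro ⟨⟨k, i, j⟩, ⟨-, h1, h2⟩, rfl⟩
      exact interleaves_pairList (fun _ => Nat.zero_le _) h1 h2
    · intro h
      obtain ⟨k, i, j, rfl, -, h1, h2⟩ := exists_pairList_eq h
      refine ⟨⟨k, i, j⟩, ⟨?_, h1, h2⟩, rfl⟩
      -- Injectivity gives `k ≤ d`, so summing over `k < d + 1` misses no sequence.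
      have hi : Function.Injective i := by
        have : StrictMono i := fun α β hαβ => (h1 α).trans_lt (h2 α β hαβ)
        exact this.injective
      have := Fintype.card_le_of_injective i hi
      simp only [Fintype.card_fin] at this
      simp only
      omega
  have e1 : ∑ k ∈ Finset.range (d + 1), ∑ ij ∈ interleaved d k, Φ (pairList ij.1 ij.2) =
      ∑ l ∈ V, Φ l := by
    rw [Finset.sum_sigma', Finset.sum_image]
    rintro ⟨k, i, j⟩ - ⟨k', i', j'⟩ - h
    have h' := List.ofFn_inj'.1 h
    rw [Sigma.mk.injEq] at h'
    obtain ⟨rfl, h'⟩ := h'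
    have h' := eq_of_heq h'
    have hi : i = i' := funext fun α => Fin.ext (congrArg Prod.fst (congrFun h' α))
    have hj : j = j' := funext fun α => Fin.ext (congrArg Prod.snd (congrFun h' α))
    rw [hi, hj]
  rw [e1, sumTail, Finset.sum_sigma']
  symm
  refine Finset.sum_nbij (fun q => positions 0 q.1.1 q.2) ?_ ?_ ?_ ?_
  · rintro ⟨⟨u, v⟩, c⟩ h
    simp only [Finset.mem_sigma, mem_splits, mem_chains] at h
    obtain ⟨rfl, rfl⟩ := h
    exact (hV _).2 (interleaves_positions (by simpa using hw))
  · rintro ⟨⟨u, v⟩, c⟩ h ⟨⟨u', v'⟩, c'⟩ h' he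
    simp only [Finset.mem_coe, Finset.mem_sigma, mem_splits, mem_chains] at h h'
    obtain ⟨h1, rfl⟩ := h
    obtain ⟨h2, rfl⟩ := h'
    obtain ⟨rfl, rfl⟩ := positions_inj he (h1.trans h2.symm)
    rfl
  · intro l hl
    obtain ⟨u, c, h1, h2⟩ := exists_positions_eq ((hV l).1 hl) (w := w) (by simpa using hw)
    exact ⟨⟨(u, chainWord c), c⟩, by simpa using h1, h2⟩
  · simp

end Positions

/-! ### Additivity of the logarithm symbols -/

section Log

/-- As the difference of a potential at the two endpoints, the logarithm is additive whatever the
order of the endpoints. -/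
lemma logSymbol_eq (a b : ℕ+) : logSymbol a b =
    ∑ r ∈ Finset.Ico 1 b, MvPolynomial.X (Gen.log r) -
      ∑ r ∈ Finset.Ico 1 a, MvPolynomial.X (Gen.log r) := by
  have key : ∀ a b : ℕ+, a ≤ b → (∑ r ∈ Finset.Ico 1 b, MvPolynomial.X (Gen.log r) : HBar) =
      ∑ r ∈ Finset.Ico 1 a, MvPolynomial.X (Gen.log r) +
        ∑ r ∈ Finset.Ico a b, MvPolynomial.X (Gen.log r) := by
    intro a b hab
    rw [← Finset.sum_union (Finset.Ico_disjoint_Ico_consecutive _ _ _),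
      Finset.Ico_union_Ico_eq_Ico one_le hab]
  rw [logSymbol]
  rcases le_total a b with h | h
  · rw [key a b h, Finset.Ico_eq_empty_of_le h]
    simp
  · rw [key b a h, Finset.Ico_eq_empty_of_le h]
    simp

lemma logSymbol_self (a : ℕ+) : logSymbol a a = 0 := by
  rw [logSymbol_eq, sub_self]

lemma logSymbol_add (a b c : ℕ+) : logSymbol a b + logSymbol b c = logSymbol a c := by
  rw [logSymbol_eq a b, logSymbol_eq b c, logSymbol_eq a c]
  ring

lemma logSymbol_swap (a b : ℕ+) : logSymbol b a = -logSymbol a b := by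
  rw [logSymbol_eq, logSymbol_eq]
  ring

end Log

/-! ### The free monoid of endpoint pairs, and paths -/

section Edges

/-- Sequences of pairs of endpoints. -/
def Edges : Type := List (ℕ+ × ℕ+)

/-- The list underlying a sequence of pairs of endpoints. -/
def Edges.toList (y : Edges) : List (ℕ+ × ℕ+) := y

/-- Concatenation is defined even for entries that do not meet, as the word formalism requires; a
product stands for some `x_{a → b}` only when it is a path. -/
instance : Monoid Edges where
  mul y z := y.toList ++ z.toList
  one := ([] : List (ℕ+ × ℕ+))
  mul_assoc y z t := List.append_assoc y.toList z.toList t.toList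
  one_mul y := List.nil_append y.toList
  mul_one y := List.append_nil y.toList

@[simp] lemma Edges.toList_mul (y z : Edges) : (y * z).toList = y.toList ++ z.toList := rfl

@[simp] lemma Edges.toList_one : (1 : Edges).toList = [] := rfl

instance : StarMul Edges where
  star y := (y.toList.map Prod.swap).reverse
  star_involutive y := by
    change ((y.toList.map Prod.swap).reverse.map Prod.swap).reverse = y
    rw [List.map_reverse, List.reverse_reverse, List.map_map, Prod.swap_swap_eq, List.map_id]
    rfl
  star_mul y z := by
    change ((y.toList ++ z.toList).map Prod.swap).reverse =
      (z.toList.map Prod.swap).reverse ++ (y.toList.map Prod.swap).reverse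
    simp

@[simp] lemma Edges.toList_star (y : Edges) :
    (star y).toList = (y.toList.map Prod.swap).reverse := rfl

/-- The sum of the logarithms of the pairs. -/
noncomputable def Edges.log (y : Edges) : HBar := (y.toList.map fun e => logSymbol e.1 e.2).sum

/-- The first endpoint. -/
def Edges.src (y : Edges) : ℕ+ := y.toList.head?.elim 1 Prod.fst

/-- The last endpoint. -/
def Edges.tgt (y : Edges) : ℕ+ := y.toList.getLast?.elim 1 Prod.snd

lemma Edges.log_one : Edges.log 1 = 0 := by simp [Edges.log]

lemma Edges.log_mul (y z : Edges) : (y * z).log = y.log + z.log := by simp [Edges.log]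

lemma Edges.log_star (y : Edges) : (star y).log = -y.log := by
  simp only [Edges.log, Edges.toList_star, List.map_reverse, List.sum_reverse, List.map_map]
  induction y.toList with
  | nil => simp
  | cons e l ih => simp [ih, logSymbol_swap e.1 e.2, add_comm]

/-- The list consists of consecutive pairs of endpoints from `a` to `b`, with steps in the
relation `r`. -/
def IsPath (r : ℕ+ → ℕ+ → Prop) : ℕ+ → List (ℕ+ × ℕ+) → ℕ+ → Prop
  | a, [], b => a = b
  | a, e :: l, b => e.1 = a ∧ r a e.2 ∧ IsPath r e.2 l b

variable {r : ℕ+ → ℕ+ → Prop}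

lemma isPath_append {a b : ℕ+} {l l' : List (ℕ+ × ℕ+)} :
    IsPath r a (l ++ l') b ↔ ∃ c, IsPath r a l c ∧ IsPath r c l' b := by
  induction l generalizing a with
  | nil => simp [IsPath]
  | cons e l ih => simp [IsPath, ih, and_assoc]

lemma IsPath.swap_reverse {a b : ℕ+} {l : List (ℕ+ × ℕ+)} (h : IsPath r a l b) :
    IsPath (fun x y => r y x) b (l.map Prod.swap).reverse a := by
  induction l generalizing a with
  | nil => exact h.symm
  | cons e l ih =>
    obtain ⟨rfl, h1, h2⟩ := h
    rw [List.map_cons, List.reverse_cons, isPath_append]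
    exact ⟨e.2, ih h2, rfl, h1, rfl⟩

/-- The sum telescopes along the path. -/
lemma IsPath.sum_log {a b : ℕ+} {l : List (ℕ+ × ℕ+)} (h : IsPath r a l b) :
    (l.map fun e => logSymbol e.1 e.2).sum = logSymbol a b := by
  induction l generalizing a with
  | nil =>
    obtain rfl : a = b := h
    simp [logSymbol_self]
  | cons e l ih =>
    obtain ⟨rfl, h1, h2⟩ := h
    simp [ih h2, logSymbol_add]

lemma IsPath.rel [IsTrans ℕ+ r] {a b : ℕ+} {l : List (ℕ+ × ℕ+)} (h : IsPath r a l b)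
    (hl : l ≠ []) : r a b := by
  induction l generalizing a with
  | nil => exact absurd rfl hl
  | cons e l ih =>
    obtain ⟨rfl, h1, h2⟩ := h
    rcases eq_or_ne l [] with rfl | hl'
    · obtain rfl : e.2 = b := h2
      exact h1
    · exact _root_.trans h1 (ih h2 hl')

/-- The empty product has the default endpoints `1`, which is why letters are required to be
nonempty throughout. -/
lemma IsPath.src_eq {a b : ℕ+} {y : Edges} (h : IsPath r a y.toList b) (hy : y.toList ≠ []) :
    y.src = a := by
  unfold Edges.src
  generalize y.toList = l at h hy
  cases l with
  | nil => exact absurd rfl hy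
  | cons e l => exact h.1

lemma IsPath.tgt_eq {a b : ℕ+} {y : Edges} (h : IsPath r a y.toList b) (hy : y.toList ≠ []) :
    y.tgt = b := by
  unfold Edges.tgt
  generalize y.toList = l at h hy
  rcases List.eq_nil_or_concat l with rfl | ⟨l', e, rfl⟩
  · exact absurd rfl hy
  · rw [List.concat_eq_append, isPath_append] at h
    obtain ⟨c, -, -, -, h2⟩ := h
    have h2 : e.2 = b := h2
    simpa using h2

lemma Edges.src_star (y : Edges) (hy : y.toList ≠ []) : (star y).src = y.tgt := by
  unfold Edges.tgt Edges.src
  rw [Edges.toList_star]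
  generalize y.toList = l at hy
  rcases List.eq_nil_or_concat l with rfl | ⟨l', e, rfl⟩
  · exact absurd rfl hy
  · simp

lemma Edges.tgt_star (y : Edges) (hy : y.toList ≠ []) : (star y).tgt = y.src := by
  unfold Edges.tgt Edges.src
  rw [Edges.toList_star]
  generalize y.toList = l at hy
  cases l with
  | nil => exact absurd rfl hy
  | cons e l => simp

end Edges

/-! ### Characters as coefficient data on words -/

section Coeffs

set_option linter.unusedSectionVars false

variable {R : Type} [CommRing R] [Algebra ℚ R]

/-- The power series without constant term. -/
abbrev Arg (R : Type) [CommRing R] : Type :=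
  RingHom.ker (MvPowerSeries.constantCoeff : Ser R →+* R)

lemma constantCoeff_arg (s : Arg R) : MvPowerSeries.constantCoeff (s : Ser R) = 0 := s.2

/-- The `m`-th endpoint of a word. -/
def endpoint {S : Type*} (w : List (Edges × S)) (m : ℕ) : ℕ+ :=
  (w.map (fun x => x.1.src) ++ [w.getLast?.elim 1 fun x => x.1.tgt]).getD m 1

/-- The generating series and the exponentials evaluated by a homomorphism. -/
noncomputable def symbCoeffs (f : HBar →ₐ[ℚ] R) : Coeffs Edges (Arg R) (Ser R) where
  G w := evalSeries f (k := w.length) (fun m => endpoint w m) (fun m => (w.get m).2.1)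
  E y s := evalExp f y.log s.1
  G_nil := evalSeries_zero f rfl _ _
  E_one s := by rw [Edges.log_one, evalExp_zero_left]
  E_mul y z s := by rw [Edges.log_mul, evalExp_add_left f _ _ (constantCoeff_arg s)]
  E_zero y := evalExp_zero_right f _
  E_add y s t := evalExp_add_right f _ (constantCoeff_arg s) (constantCoeff_arg t)
  E_star y s := by
    rw [Edges.log_star, evalExp_neg]
    rfl

/-- Links words to sequences of endpoints. `endpoint` reads the sources and only the last target, so
the other targets play no role in the value; the hypothesis on all letters describes a word whose
letters meet. -/
lemma symbCoeffs_G_eq (f : HBar →ₐ[ℚ] R) {w : List (Edges × Arg R)} {k : ℕ} (hk : w.length = k)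
    {p : ℕ → ℕ+} {s : ℕ → Ser R}
    (h : ∀ m (hm : m < w.length), w[m].1.src = p m ∧ w[m].1.tgt = p (m + 1) ∧ w[m].2.1 = s m) :
    (symbCoeffs f).G w = evalSeries f (k := k) (fun m => p m) (fun m => s m) := by
  rcases Nat.eq_zero_or_pos k with h0 | h0
  · rw [evalSeries_zero f h0]
    exact evalSeries_zero f (hk.trans h0) _ _
  · refine evalSeries_congr f hk (fun m h1 h2 => ?_) (fun m h1 h2 => (h m h1).2.2)
    simp only [endpoint]
    rcases Nat.lt_or_ge m w.length with hm | hm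
    · rw [List.getD_eq_getElem _ _ (by simpa using h1),
        List.getElem_append_left (by simpa using hm), List.getElem_map]
      exact (h m hm).1
    · obtain rfl : m = w.length := by omega
      have h3 : w.length - 1 < w.length := by omega
      have h4 : w.length - 1 + 1 = w.length := by omega
      rw [List.getD_eq_getElem _ _ (by simp),
        List.getElem_append_right (by simp)]
      have := (h _ h3).2.1
      rw [h4] at this
      simp [List.getLast?_eq_getElem?, h3, this]

/-- The letters of `w` are paths between the points `p`, and their arguments are `s`, starting
from position `lo`. -/
def Along (r : ℕ+ → ℕ+ → Prop) (p : ℕ → ℕ+) (s : ℕ → Ser R) : ℕ → List (Edges × Arg R) → Prop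
  | _, [] => True
  | lo, x :: w => (x.1.toList ≠ [] ∧ IsPath r (p lo) x.1.toList (p (lo + 1)) ∧ x.2.1 = s lo) ∧
      Along r p s (lo + 1) w

variable {r : ℕ+ → ℕ+ → Prop} {p : ℕ → ℕ+} {s : ℕ → Ser R}

lemma along_append {lo : ℕ} {u v : List (Edges × Arg R)} :
    Along r p s lo (u ++ v) ↔ Along r p s lo u ∧ Along r p s (lo + u.length) v := by
  induction u generalizing lo with
  | nil => simp [Along]
  | cons x u ih =>
    simp only [List.cons_append, Along, ih, List.length_cons, and_assoc]
    rw [show lo + (u.length + 1) = lo + 1 + u.length by omega]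

lemma Along.getElem {lo : ℕ} {w : List (Edges × Arg R)} (h : Along r p s lo w) (m : ℕ)
    (hm : m < w.length) : w[m].1.toList ≠ [] ∧
      IsPath r (p (lo + m)) w[m].1.toList (p (lo + m + 1)) ∧ w[m].2.1 = s (lo + m) := by
  induction w generalizing lo m with
  | nil => simp at hm
  | cons x w ih =>
    cases m with
    | zero => exact h.1
    | succ m =>
      have := ih h.2 m (by simpa using hm)
      rwa [show lo + 1 + m = lo + (m + 1) by omega] at this

lemma Along.isPath {lo : ℕ} {w : List (Edges × Arg R)} (h : Along r p s lo w) :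
    IsPath r (p lo) (prodY w).toList (p (lo + w.length)) := by
  induction w generalizing lo with
  | nil => rfl
  | cons x w ih =>
    rw [prodY_cons, Edges.toList_mul, isPath_append]
    refine ⟨_, h.1.2.1, ?_⟩
    have := ih h.2
    rwa [show lo + 1 + w.length = lo + (w.length + 1) by omega] at this

lemma prodY_ne_nil {lo : ℕ} {w : List (Edges × Arg R)} (h : Along r p s lo w) (hw : w ≠ []) :
    (prodY w).toList ≠ [] := by
  cases w with
  | nil => exact absurd rfl hw
  | cons x w => simp [h.1.1]

/-- `rev` reverses each path, so the left part of the block runs through the endpoints backwards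
from the mark, as the inverted symbol does in the coproduct formula. -/
lemma blockCoeff_symbCoeffs (g : HBar →ₐ[ℚ] R) {a : ℕ} (b : Block (Edges × Arg R))
    (h : Along r p s a b.word) :
    blockCoeff (symbCoeffs g) b =
      blockEval g p s a (a + b.1.length) (a + b.1.length + 1 + b.2.2.length) := by
  obtain ⟨x, y, v⟩ := b
  have hy : y.2.1 = s (a + x.length) := by
    have := (along_append.1 h).2.1.2.2
    exact this
  have hx : Along r p s a x := (along_append.1 h).1
  have hv : Along r p s (a + x.length + 1) v := (along_append.1 h).2.2
  have hl : (Block.word (x, y, v)).length = x.length + 1 + v.length := by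
    simp [Block.word]
    omega
  have hE : (symbCoeffs g).E (prodY (Block.word (x, y, v))) y.2 =
      evalExp g (logSymbol (p a) (p (a + x.length + 1 + v.length))) (s (a + x.length)) := by
    change evalExp g (Edges.log _) y.2.1 = _
    have := h.isPath.sum_log
    rw [hy, Edges.log, this, hl, add_assoc, add_assoc, add_assoc]
  have hR : (symbCoeffs g).G (rev y.2 x) = evalSeries g (k := a + x.length - a)
      (fun m => p (a + x.length - (m : ℕ)))
      (fun m => s (a + x.length) - s (a + x.length - 1 - (m : ℕ))) := by
    refine symbCoeffs_G_eq g (p := fun m => p (a + x.length - m))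
      (s := fun m => s (a + x.length) - s (a + x.length - 1 - m)) (by simp) fun m hm => ?_
    have hm' : m < x.length := by simpa using hm
    have e : (rev y.2 x)[m] = starLetter y.2 x[x.length - 1 - m] := by
      simp [rev, List.getElem_reverse]
    obtain ⟨h1, h2, h3⟩ := hx.getElem (x.length - 1 - m) (by omega)
    rw [e]
    refine ⟨?_, ?_, ?_⟩
    · simp only [starLetter]
      rw [Edges.src_star _ h1, h2.tgt_eq h1]
      congr 1
      omega
    · simp only [starLetter]
      rw [Edges.tgt_star _ h1, h2.src_eq h1]
      congr 1
      omega
    · simp only [starLetter, Submodule.coe_sub, hy, h3]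
      congr 2
      omega
  have hS : (symbCoeffs g).G (shift y.2 v) =
      evalSeries g (k := a + x.length + 1 + v.length - 1 - (a + x.length))
      (fun m => p (a + x.length + 1 + (m : ℕ)))
      (fun m => s (a + x.length + 1 + (m : ℕ)) - s (a + x.length)) := by
    refine symbCoeffs_G_eq g (p := fun m => p (a + x.length + 1 + m))
      (s := fun m => s (a + x.length + 1 + m) - s (a + x.length)) (by rw [length_shift]; omega) fun m hm => ?_
    have hm' : m < v.length := by simpa using hm
    have e : (shift y.2 v)[m] = shiftLetter y.2 v[m] := by simp [shift]
    obtain ⟨h1, h2, h3⟩ := hv.getElem m hm'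
    rw [e]
    refine ⟨?_, ?_, ?_⟩
    · simp only [shiftLetter]
      rw [h2.src_eq h1]
    · simp only [shiftLetter]
      rw [h2.tgt_eq h1]
      rfl
    · simp only [shiftLetter, Submodule.coe_sub, hy, h3]
  simp only [blockCoeff, blockEval, hE, hR, hS]
  rw [show a + x.length - a = x.length by omega]

end Coeffs

/-! ### Comparison of the indexed formula with the word formula -/

section Terms

set_option linter.unusedSectionVars false

variable {R : Type} [CommRing R] [Algebra ℚ R]

/-- The `m`-th starting position, or `d` beyond the end of the list. -/
def startAt (d : ℕ) (l : List (ℕ × ℕ)) (m : ℕ) : ℕ := (l.map Prod.fst).getD m d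

/-- The `m`-th marked position. -/
def markAt (l : List (ℕ × ℕ)) (m : ℕ) : ℕ := (l.map Prod.snd).getD m 0

/-- The product of the factors `blockEval` for a list of positions. -/
noncomputable def blockProd (g : HBar →ₐ[ℚ] R) (p : ℕ → ℕ+) (s : ℕ → Ser R) (d : ℕ) :
    List (ℕ × ℕ) → Ser R
  | [] => 1
  | (a, b) :: l => blockEval g p s a b (startAt d l 0) * blockProd g p s d l

/-- `termEval` for a list of positions. -/
noncomputable def termList (f g : HBar →ₐ[ℚ] R) (p : ℕ → ℕ+) (s : ℕ → Ser R) (d : ℕ)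
    (l : List (ℕ × ℕ)) : Ser R :=
  evalSeries f (k := l.length) (fun m => p (startAt d l m)) (fun m => s (markAt l m)) *
    (evalSeries g (k := startAt d l 0) (fun m => p m) (fun m => s m) * blockProd g p s d l)

lemma startAt_pairList {d k : ℕ} (i j : Fin k → Fin d) (m : ℕ) :
    startAt d (pairList i j) m = upper i m := by
  unfold startAt upper pairList
  split_ifs with h <;> simp [List.getD_eq_getElem?_getD, h]

lemma markAt_pairList {d k : ℕ} (i j : Fin k → Fin d) (m : Fin k) :
    markAt (pairList i j) m = j m := by
  unfold markAt pairList
  simp [List.getD_eq_getElem?_getD]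

lemma prod_blockEval (g : HBar →ₐ[ℚ] R) (p : ℕ → ℕ+) (s : ℕ → Ser R) {d k : ℕ}
    (i j : Fin k → Fin d) :
    ∏ α : Fin k, blockEval g p s (i α : ℕ) (j α : ℕ) (upper i ((α : ℕ) + 1)) =
      blockProd g p s d (pairList i j) := by
  induction k with
  | zero => simp [pairList, blockProd]
  | succ k ih =>
    have h1 : pairList i j =
        ((i 0 : ℕ), (j 0 : ℕ)) :: pairList (fun α => i α.succ) (fun α => j α.succ) := by
      rw [pairList, List.ofFn_succ]
      rfl
    have h2 : ∀ m, upper i (m + 1) = upper (fun α : Fin k => i α.succ) m := by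
      intro m
      unfold upper
      by_cases hm : m < k
      · rw [dif_pos hm, dif_pos (by omega)]
        rfl
      · rw [dif_neg hm, dif_neg (by omega)]
    rw [Fin.prod_univ_succ, h1, blockProd, startAt_pairList, ← ih]
    simp only [h2, Fin.val_succ, Fin.val_zero]

lemma termEval_eq (f g : HBar →ₐ[ℚ] R) (p : ℕ → ℕ+) (s : ℕ → Ser R) {d k : ℕ}
    (i j : Fin k → Fin d) : termEval f g p s i j = termList f g p s d (pairList i j) := by
  unfold termEval termList
  rw [prod_blockEval]
  refine congrArg₂ _ ?_ (congrArg₂ _ ?_ rfl)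
  · refine evalSeries_congr f (by simp [pairList]) (fun m _ _ => ?_) fun m h1 _ => ?_
    · rw [startAt_pairList]
    · simp only
      rw [← markAt_pairList i j ⟨m, h1⟩]
  · exact evalSeries_congr g (startAt_pairList i j 0).symm (fun m _ _ => rfl) fun m _ _ => rfl

variable {r : ℕ+ → ℕ+ → Prop} {p : ℕ → ℕ+} {s : ℕ → Ser R}

lemma startAt_positions {X : Type*} {d lo : ℕ} {u : List X} {c : List (Block X)}
    (h : lo + (u ++ chainWord c).length = d) :
    startAt d (positions lo u c) 0 = lo + u.length := by
  cases c with
  | nil => simpa [startAt, positions] using h.symm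
  | cons b c => rfl

/-- A block ends where the next one starts, so its right part is carried along as the word `u` of
the induction hypothesis. The second conclusion locates the merged letters. -/
lemma chainCoeff_symbCoeffs (g : HBar →ₐ[ℚ] R) {d lo : ℕ} {u : List (Edges × Arg R)}
    {c : List (Block (Edges × Arg R))} (h : lo + (u ++ chainWord c).length = d)
    (ha : Along r p s lo (u ++ chainWord c)) :
    chainCoeff (symbCoeffs g) c = blockProd g p s d (positions lo u c) ∧
    ∀ m (hm : m < c.length), (merge (c.get ⟨m, hm⟩)).1.toList ≠ [] ∧
      IsPath r (p (startAt d (positions lo u c) m)) (merge (c.get ⟨m, hm⟩)).1.toList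
        (p (startAt d (positions lo u c) (m + 1))) ∧
      (merge (c.get ⟨m, hm⟩)).2.1 = s (markAt (positions lo u c) m) := by
  induction c generalizing lo u with
  | nil => exact ⟨rfl, by simp⟩
  | cons b c ih =>
    have hb : Along r p s (lo + u.length) (b.word ++ chainWord c) := (along_append.1 ha).2
    have hb' := (along_append.1 hb).1
    obtain ⟨x, y, v⟩ := b
    simp only [chainWord_cons, Block.word, List.length_append, List.length_cons] at h
    have h' : lo + u.length + x.length + 1 + (v ++ chainWord c).length = d := by
      rw [List.length_append]
      omega
    have ha' : Along r p s (lo + u.length + x.length + 1) (v ++ chainWord c) := by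
      have : Along r p s (lo + u.length) ((x ++ y :: v) ++ chainWord c) := hb
      rw [List.append_assoc, along_append] at this
      exact this.2.2
    obtain ⟨ih1, ih2⟩ := ih h' ha'
    have hs := startAt_positions h'
    constructor
    · rw [chainCoeff_cons, ih1, blockCoeff_symbCoeffs g _ hb', positions, blockProd, hs]
    · intro m hm
      cases m with
      | zero =>
        refine ⟨prodY_ne_nil hb' (Block.word_ne_nil _), ?_, ?_⟩
        · have h1 := hb'.isPath
          have e : startAt d (positions lo u ((x, y, v) :: c)) (0 + 1) =
              lo + u.length + (Block.word (x, y, v)).length := by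
            change startAt d (positions (lo + u.length + x.length + 1) v c) 0 = _
            rw [hs]
            simp [Block.word]
            omega
          rw [e]
          exact h1
        · exact (along_append.1 hb').2.1.2.2
      | succ m => exact ih2 m (by simpa using hm)

/-- Termwise comparison under the bijection of `sum_interleaved_eq`. -/
lemma sumEval_eq_coprodForm (f g : HBar →ₐ[ℚ] R) {w : List (Edges × Arg R)}
    (hw : Along r p s 0 w) :
    sumEval f g p s w.length = coprodForm (symbCoeffs f).G (symbCoeffs g) w := by
  unfold sumEval coprodForm
  simp only [termEval_eq]
  rw [sum_interleaved_eq rfl (termList f g p s w.length)]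
  unfold sumTail
  refine Finset.sum_congr rfl fun x hx => Finset.sum_congr rfl fun c hc => ?_
  have hxc : x.1 ++ chainWord c = w := by rw [mem_chains.1 hc, mem_splits.1 hx]
  have hlen : 0 + (x.1 ++ chainWord c).length = w.length := by rw [hxc, zero_add]
  rw [← hxc] at hw
  obtain ⟨h1, h2⟩ := chainCoeff_symbCoeffs g hlen hw
  have hs := startAt_positions hlen
  rw [zero_add] at hs
  have hl : ∀ (c : List (Block (Edges × Arg R))) (lo : ℕ) (u : List (Edges × Arg R)),
      (positions lo u c).length = c.length := by
    intro c
    induction c with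
    | nil => simp [positions]
    | cons b c ih => intro lo u; simp [positions, ih]
  have hG : (symbCoeffs g).G x.1 = evalSeries g (k := startAt w.length (positions 0 x.1 c) 0)
      (fun m => p m) (fun m => s m) := by
    refine symbCoeffs_G_eq g hs.symm fun m hm => ?_
    obtain ⟨g1, g2, g3⟩ := (along_append.1 hw).1.getElem m hm
    rw [zero_add] at g2 g3
    exact ⟨g2.src_eq g1, g2.tgt_eq g1, g3⟩
  have hF : (symbCoeffs f).G (c.map merge) = evalSeries f (k := (positions 0 x.1 c).length)
      (fun m => p (startAt w.length (positions 0 x.1 c) m))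
      (fun m => s (markAt (positions 0 x.1 c) m)) := by
    refine symbCoeffs_G_eq f (p := fun m => p (startAt w.length (positions 0 x.1 c) m))
      (s := fun m => s (markAt (positions 0 x.1 c) m)) (by simp [hl]) fun m hm => ?_
    obtain ⟨g1, g2, g3⟩ := h2 m (by simpa using hm)
    rw [List.getElem_map]
    exact ⟨g2.src_eq g1, g2.tgt_eq g1, g3⟩
  simp only [termList]
  rw [← hG, ← hF, h1]
  ring

end Terms

/-! ### Monotone words and associativity of convolution on them -/

section MonotoneWords

set_option linter.unusedSectionVars false

variable {S A : Type*} [AddCommGroup S] [CommRing A] {R : Type} [CommRing R] [Algebra ℚ R]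

/-- The word is a path with steps in the relation `r` and without empty letters. -/
def WordPath (r : ℕ+ → ℕ+ → Prop) (a : ℕ+) (w : List (Edges × S)) (b : ℕ+) : Prop :=
  (∀ x ∈ w, x.1.toList ≠ []) ∧ IsPath r a (prodY w).toList b

/-- The word is a strictly monotone path. -/
def IsMonotoneWord (w : List (Edges × S)) : Prop :=
  ∃ a b, WordPath (· < ·) a w b ∨ WordPath (· > ·) a w b

variable {r : ℕ+ → ℕ+ → Prop} {a b : ℕ+}

lemma wordPath_append {u v : List (Edges × S)} :
    WordPath r a (u ++ v) b ↔ ∃ c, WordPath r a u c ∧ WordPath r c v b := by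
  simp only [WordPath, prodY_append, Edges.toList_mul, isPath_append, List.mem_append, or_imp,
    forall_and]
  constructor
  · rintro ⟨⟨h1, h2⟩, c, h3, h4⟩
    exact ⟨c, ⟨h1, h3⟩, h2, h4⟩
  · rintro ⟨c, ⟨h1, h3⟩, h2, h4⟩
    exact ⟨⟨h1, h2⟩, c, h3, h4⟩

lemma prodY_toList_ne_nil {w : List (Edges × S)} (h : ∀ x ∈ w, x.1.toList ≠ []) (hw : w ≠ []) :
    (prodY w).toList ≠ [] := by
  cases w with
  | nil => exact absurd rfl hw
  | cons x w => simp [h x]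

lemma WordPath.map_merge {c : List (Block (Edges × S))} (h : WordPath r a (chainWord c) b) :
    WordPath r a (c.map merge) b := by
  refine ⟨?_, by rw [prodY_map_merge]; exact h.2⟩
  intro x hx
  obtain ⟨d, hd, rfl⟩ := List.mem_map.1 hx
  refine prodY_toList_ne_nil (fun x hx => h.1 x ?_) d.word_ne_nil
  exact List.mem_flatMap.2 ⟨d, hd, hx⟩

lemma WordPath.shift {w : List (Edges × S)} (h : WordPath r a w b) (t : S) :
    WordPath r a (shift t w) b := by
  refine ⟨?_, by rw [prodY_shift]; exact h.2⟩
  intro x hx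
  obtain ⟨y, hy, rfl⟩ := List.mem_map.1 hx
  exact h.1 y hy

lemma WordPath.rev {w : List (Edges × S)} (h : WordPath r a w b) (t : S) :
    WordPath (fun x y => r y x) b (rev t w) a := by
  refine ⟨?_, by rw [prodY_rev]; exact h.2.swap_reverse⟩
  intro x hx
  obtain ⟨y, hy, rfl⟩ := List.mem_map.1 (List.mem_reverse.1 hx)
  simpa [starLetter] using h.1 y hy

lemma IsMonotoneWord.append {u v : List (Edges × S)} (h : IsMonotoneWord (u ++ v)) :
    IsMonotoneWord u ∧ IsMonotoneWord v := by
  obtain ⟨a, b, h | h⟩ := h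
  · obtain ⟨c, h1, h2⟩ := wordPath_append.1 h
    exact ⟨⟨a, c, Or.inl h1⟩, c, b, Or.inl h2⟩
  · obtain ⟨c, h1, h2⟩ := wordPath_append.1 h
    exact ⟨⟨a, c, Or.inr h1⟩, c, b, Or.inr h2⟩

lemma IsMonotoneWord.map_merge {c : List (Block (Edges × S))} (h : IsMonotoneWord (chainWord c)) :
    IsMonotoneWord (c.map merge) := by
  obtain ⟨a, b, h | h⟩ := h
  · exact ⟨a, b, Or.inl h.map_merge⟩
  · exact ⟨a, b, Or.inr h.map_merge⟩

lemma IsMonotoneWord.shift {w : List (Edges × S)} (h : IsMonotoneWord w) (t : S) :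
    IsMonotoneWord (shift t w) := by
  obtain ⟨a, b, h | h⟩ := h
  · exact ⟨a, b, Or.inl (h.shift t)⟩
  · exact ⟨a, b, Or.inr (h.shift t)⟩

lemma IsMonotoneWord.rev {w : List (Edges × S)} (h : IsMonotoneWord w) (t : S) :
    IsMonotoneWord (rev t w) := by
  obtain ⟨a, b, h | h⟩ := h
  · exact ⟨b, a, Or.inr (h.rev t)⟩
  · exact ⟨b, a, Or.inl (h.rev t)⟩

/-- The formula evaluates `F` and `G` only at subwords, merged words, shifts and reversals of `w`,
all of which are monotone. This makes identities known only on monotone words sufficient. -/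
lemma coprodForm_congr {F F' : List (Edges × S) → A} {h h' : Coeffs Edges S A}
    (hF : ∀ w, IsMonotoneWord w → F w = F' w) (hG : ∀ w, IsMonotoneWord w → h.G w = h'.G w)
    (hE : ∀ y s, h.E y s = h'.E y s) {w : List (Edges × S)} (hw : IsMonotoneWord w) :
    coprodForm F h w = coprodForm F' h' w := by
  unfold coprodForm sumTail
  refine Finset.sum_congr rfl fun x hx => Finset.sum_congr rfl fun c hc => ?_
  obtain rfl := mem_splits.1 hx
  have h1 := hw.append.1
  have h2 := hw.append.2
  rw [← mem_chains.1 hc] at h2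
  have h3 : chainCoeff h c = chainCoeff h' c := by
    clear hc
    induction c with
    | nil => rfl
    | cons b c ih =>
      obtain ⟨u, y, v⟩ := b
      have h4 := IsMonotoneWord.append (u := Block.word (u, y, v)) h2
      have h5 := IsMonotoneWord.append (u := u) h4.1
      have h6 := IsMonotoneWord.append (u := [y]) h5.2
      rw [chainCoeff_cons, chainCoeff_cons, ih h4.2, blockCoeff, blockCoeff, hE,
        hG _ (h5.1.rev _), hG _ (h6.2.shift _)]
  simp only [hG _ h1, h3, hF _ h2.map_merge]

lemma Along.congr {p p' : ℕ → ℕ+} {s s' : ℕ → Ser R} {lo lo' : ℕ} {w : List (Edges × Arg R)}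
    (h : Along r p s lo w) (hp : ∀ m ≤ w.length, p' (lo' + m) = p (lo + m))
    (hs : ∀ m < w.length, s' (lo' + m) = s (lo + m)) : Along r p' s' lo' w := by
  induction w generalizing lo lo' with
  | nil => trivial
  | cons x w ih =>
    simp only [List.length_cons] at hp hs
    refine ⟨⟨h.1.1, ?_, ?_⟩, ih h.2 (fun m hm => ?_) fun m hm => ?_⟩
    · have h0 := hp 0 (by omega)
      have h1 := hp 1 (by omega)
      simp only [add_zero] at h0
      rw [h0, h1]
      exact h.1.2.1
    · have h0 := hs 0 (by omega)
      simp only [add_zero] at h0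
      rw [h0]
      exact h.1.2.2
    · have := hp (m + 1) (by omega)
      rwa [show lo' + 1 + m = lo' + (m + 1) by omega, show lo + 1 + m = lo + (m + 1) by omega]
    · have := hs (m + 1) (by omega)
      rwa [show lo' + 1 + m = lo' + (m + 1) by omega, show lo + 1 + m = lo + (m + 1) by omega]

lemma WordPath.exists_along {w : List (Edges × Arg R)} (h : WordPath r a w b) :
    ∃ (p : ℕ → ℕ+) (s : ℕ → Ser R), p 0 = a ∧ Along r p s 0 w ∧
      ∀ m, (s m).constantCoeff = 0 := by
  induction w generalizing a with
  | nil => exact ⟨fun _ => a, fun _ => 0, rfl, trivial, by simp⟩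
  | cons x w ih =>
    obtain ⟨c, h1, h2⟩ := (wordPath_append (u := [x])).1 h
    obtain ⟨p, s, hp, ha, hs⟩ := ih h2
    refine ⟨fun m => m.casesOn a p, fun m => m.casesOn x.2.1 s, rfl, ⟨⟨h1.1 x (by simp), ?_, rfl⟩,
      ha.congr (fun m _ => ?_) fun m _ => ?_⟩, ?_⟩
    · have := h1.2
      rw [prodY_cons, prodY_nil, mul_one] at this
      simpa [hp] using this
    · rw [show 0 + 1 + m = m + 1 by omega, zero_add]
    · rw [show 0 + 1 + m = m + 1 by omega, zero_add]
    · intro m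
      cases m with
      | zero => exact constantCoeff_arg x.2
      | succ m => exact hs m

/-- The relation is kept general to treat both orders at once; `hr` ensures that `bracket` is a
genuine generator and not its default `0`. -/
lemma symbCoeffs_convolve_of_wordPath [IsTrans ℕ+ r] (f g : HBar →ₐ[ℚ] R)
    {w : List (Edges × Arg R)} (h : WordPath r a w b)
    (hr : ∀ (d : ℕ) (p : Fin (d + 1) → ℕ+), (∀ i : Fin d, r (p i.castSucc) (p i.succ)) →
      StrictMono p ∨ StrictAnti p) :
    (symbCoeffs (convolve f g)).G w = coprodForm (symbCoeffs f).G (symbCoeffs g) w := by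
  rcases eq_or_ne w [] with rfl | hw
  · rw [Coeffs.G_nil]
    exact ((symbCoeffs f).conv (symbCoeffs g)).G_nil.symm
  obtain ⟨p, s, -, ha, hs⟩ := h.exists_along
  have hd : w.length ≠ 0 := by simpa using hw
  have hp := hr w.length (fun m => p m) fun i => by
    obtain ⟨h1, h2, -⟩ := ha.getElem i i.2
    rw [zero_add] at h2
    exact h2.rel h1
  rw [symbCoeffs_G_eq (convolve f g) rfl (p := p) (s := s) fun m hm => by
    obtain ⟨h1, h2, h3⟩ := ha.getElem m hm
    rw [zero_add] at h2 h3
    exact ⟨h2.src_eq h1, h2.tgt_eq h1, h3⟩]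
  rw [evalSeries_convolve f g hd (fun m => p m) hp hs]
  refine sumEval_eq_coprodForm f g (ha.congr (fun m hm => ?_) fun _ _ => rfl)
  simp only [zero_add, Fin.val_ofNat]
  rw [Nat.mod_eq_of_lt (by omega)]

theorem symbCoeffs_convolve (f g : HBar →ₐ[ℚ] R) {w : List (Edges × Arg R)}
    (h : IsMonotoneWord w) :
    (symbCoeffs (convolve f g)).G w = coprodForm (symbCoeffs f).G (symbCoeffs g) w := by
  obtain ⟨a, b, h | h⟩ := h
  · exact symbCoeffs_convolve_of_wordPath f g h fun d p hp =>
      Or.inl (Fin.strictMono_iff_lt_succ.2 hp)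
  · exact symbCoeffs_convolve_of_wordPath f g h fun d p hp =>
      Or.inr (Fin.strictAnti_iff_succ_lt.2 hp)

lemma convolve_X_log (f g : HBar →ₐ[ℚ] R) (i : ℕ+) :
    convolve f g (MvPolynomial.X (Gen.log i)) =
      f (MvPolynomial.X (Gen.log i)) + g (MvPolynomial.X (Gen.log i)) := by
  simp [convolve, comul, comulGen]

lemma convolve_log (f g : HBar →ₐ[ℚ] R) (y : Edges) :
    convolve f g y.log = f y.log + g y.log := by
  unfold Edges.log
  induction y.toList with
  | nil => simp
  | cons e l ih =>
    simp only [List.map_cons, List.sum_cons, map_add, ih]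
    have : convolve f g (logSymbol e.1 e.2) = f (logSymbol e.1 e.2) + g (logSymbol e.1 e.2) := by
      simp only [logSymbol, map_sub, map_sum, convolve_X_log, Finset.sum_add_distrib]
      ring
    rw [this]
    ring

lemma symbCoeffs_convolve_E (f g : HBar →ₐ[ℚ] R) (y : Edges) (s : Arg R) :
    (symbCoeffs (convolve f g)).E y s = (symbCoeffs f).E y s * (symbCoeffs g).E y s := by
  change evalExp _ _ _ = evalExp _ _ _ * evalExp _ _ _
  have hs := constantCoeff_arg s
  rw [evalExp, evalExp, evalExp, ← exp_subst_add (by simp [hs]) (by simp [hs]), convolve_log,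
    map_add, add_mul]

lemma convolve_assoc_G (f g h : HBar →ₐ[ℚ] R) {w : List (Edges × Arg R)}
    (hw : IsMonotoneWord w) :
    (symbCoeffs (convolve (convolve f g) h)).G w =
      (symbCoeffs (convolve f (convolve g h))).G w := by
  rw [symbCoeffs_convolve _ _ hw, symbCoeffs_convolve _ _ hw,
    coprodForm_congr (fun w hw => symbCoeffs_convolve f g hw) (fun _ _ => rfl) (fun _ _ => rfl) hw,
    coprodForm_coprodForm]
  exact coprodForm_congr (fun _ _ => rfl) (fun w hw => (symbCoeffs_convolve g h hw).symm)
    (fun y s => (symbCoeffs_convolve_E g h y s).symm) hw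

/-- The variable `t i` as an argument. -/
noncomputable def argX (R : Type) [CommRing R] (i : ℕ) : Arg R :=
  ⟨MvPowerSeries.X i, by simp [RingHom.mem_ker]⟩

/-- The word of a symbol with the variables as arguments. -/
noncomputable def PolySymbol.word (R : Type) [CommRing R] (s : PolySymbol) :
    List (Edges × Arg R) :=
  List.ofFn fun m : Fin s.depth =>
    (([(s.pt m.castSucc, s.pt m.succ)] : List (ℕ+ × ℕ+)), argX R m)

end MonotoneWords

/-! ### The counit in the word formula -/

section Units

set_option linter.unusedSectionVars false

variable {Y S A : Type*} [Monoid Y] [StarMul Y] [AddCommGroup S] [CommRing A]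

/-- Only the cutting with all of `w` as prefix and no blocks survives. -/
lemma coprodForm_unit_left {F : List (Y × S) → A} (hF : F [] = 1) (hF' : ∀ w, w ≠ [] → F w = 0)
    (h : Coeffs Y S A) (w : List (Y × S)) : coprodForm F h w = h.G w := by
  unfold coprodForm sumTail
  rw [Finset.sum_eq_single_of_mem (w, []) (by simp), Finset.sum_eq_single_of_mem [] (by simp)]
  · simp [hF]
  · intro c _ hc
    simp [hF' (c.map merge) (by simpa using hc)]
  · rintro ⟨u, v⟩ huv hne
    refine Finset.sum_eq_zero fun c hc => ?_
    have hc' : c ≠ [] := by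
      rintro rfl
      obtain rfl : [] = v := mem_chains.1 hc
      refine hne ?_
      have : u = w := by simpa using huv
      rw [this]
    simp [hF' (c.map merge) (by simpa using hc')]

/-- The word cut into its letters. -/
def letters {X : Type*} (w : List X) : List (Block X) := w.map fun y => ([], y, [])

lemma chainWord_letters {X : Type*} (w : List X) : chainWord (letters w) = w := by
  induction w with
  | nil => rfl
  | cons x w ih =>
    change [x] ++ chainWord (letters w) = _
    rw [ih]
    rfl

/-- Only the cutting with empty prefix and one-letter blocks survives, and merging it returns `w`.
-/
lemma coprodForm_unit_right (F : List (Y × S) → A) {h : Coeffs Y S A}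
    (hG : ∀ w, w ≠ [] → h.G w = 0) (hE : ∀ y s, h.E y s = 1) (w : List (Y × S)) :
    coprodForm F h w = F w := by
  have h1 : ∀ b : Block (Y × S), (b.1 ≠ [] ∨ b.2.2 ≠ []) → blockCoeff h b = 0 := by
    rintro b (hb | hb)
    · rw [blockCoeff, hG (rev _ b.1) (by simpa [rev] using hb)]
      ring
    · rw [blockCoeff, hG (shift _ b.2.2) (by simpa [shift] using hb)]
      ring
  have h2 : ∀ y : Y × S, blockCoeff h ([], y, []) = 1 := by
    intro y
    simp [blockCoeff, hE, rev, shift, h.G_nil]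
  have h3 : ∀ c : List (Block (Y × S)), c ≠ letters (chainWord c) → chainCoeff h c = 0 := by
    intro c
    induction c with
    | nil => intro hc; exact absurd rfl hc
    | cons b c ih =>
      intro hc
      rw [chainCoeff_cons]
      by_cases hb : b.1 ≠ [] ∨ b.2.2 ≠ []
      · rw [h1 b hb, zero_mul]
      · obtain ⟨u, y, v⟩ := b
        simp only [ne_eq, not_or, not_not] at hb
        obtain ⟨rfl, rfl⟩ := hb
        rw [ih, mul_zero]
        intro hc'
        refine hc ?_
        change _ = ([], y, []) :: letters (chainWord c)
        rw [← hc']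
  have h4 : chainCoeff h (letters w) = 1 := by
    induction w with
    | nil => rfl
    | cons x w ih =>
      change chainCoeff h (([], x, []) :: letters w) = 1
      rw [chainCoeff_cons, ih, h2, mul_one]
  have h5 : (letters w).map merge = w := by
    rw [letters, List.map_map]
    conv_rhs => rw [← List.map_id w]
    refine List.map_congr_left fun x _ => ?_
    simp [merge, Block.word]
  unfold coprodForm sumTail
  rw [Finset.sum_eq_single_of_mem ([], w) (by simp),
    Finset.sum_eq_single_of_mem (letters w) (by simp [chainWord_letters])]
  · simp only [h.G_nil, h4, h5, one_mul]
  · intro c hc hne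
    have : chainWord c = w := mem_chains.1 hc
    simp only
    rw [h3 c (by rwa [this])]
    ring
  · rintro ⟨u, v⟩ huv hne
    refine Finset.sum_eq_zero fun c hc => ?_
    have hu : u ≠ [] := by
      rintro rfl
      refine hne ?_
      have : v = w := by simpa using huv
      rw [this]
    simp [hG u hu]

end Units

/-! ### Characters form a monoid under convolution -/

section Hom

set_option linter.unusedSectionVars false

variable {R : Type} [CommRing R] [Algebra ℚ R]

lemma PolySymbol.getElem_word (s : PolySymbol) (m : ℕ) (hm : m < (s.word R).length)
    (hm' : m < s.depth) :
    (s.word R)[m] = (([(s.pt (Fin.castSucc ⟨m, hm'⟩), s.pt (Fin.succ ⟨m, hm'⟩))] :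
      List (ℕ+ × ℕ+)), argX R m) := by
  simp [PolySymbol.word]
  rfl

@[simp] lemma PolySymbol.length_word (s : PolySymbol) : (s.word R).length = s.depth := by
  simp [PolySymbol.word]

lemma PolySymbol.G_word (s : PolySymbol) (f : HBar →ₐ[ℚ] R) :
    (symbCoeffs f).G (s.word R) =
      evalSeries f s.pt fun m => (MvPowerSeries.X (m : ℕ) : Ser R) := by
  have hp : ∀ m (hm : m < s.depth + 1), s.pt (Fin.ofNat (s.depth + 1) m) = s.pt ⟨m, hm⟩ := by
    intro m hm
    congr 1
    exact Fin.ext (Nat.mod_eq_of_lt hm)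
  rw [symbCoeffs_G_eq f (PolySymbol.length_word s)
    (p := fun m => s.pt (Fin.ofNat (s.depth + 1) m)) (s := fun m => MvPowerSeries.X m)]
  · exact evalSeries_congr f rfl (fun m hm _ => hp m hm) fun _ _ _ => rfl
  · intro m hm
    have hm' : m < s.depth := by simpa using hm
    rw [PolySymbol.getElem_word s m hm hm']
    exact ⟨(hp m (by omega)).symm, (hp (m + 1) (by omega)).symm, rfl⟩

lemma along_of_getElem {r : ℕ+ → ℕ+ → Prop} {p : ℕ → ℕ+} {s : ℕ → Ser R} {lo : ℕ}
    {w : List (Edges × Arg R)}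
    (h : ∀ m (hm : m < w.length), w[m].1.toList ≠ [] ∧
      IsPath r (p (lo + m)) w[m].1.toList (p (lo + m + 1)) ∧ w[m].2.1 = s (lo + m)) :
    Along r p s lo w := by
  induction w generalizing lo with
  | nil => trivial
  | cons x w ih =>
    refine ⟨h 0 (by simp), ih fun m hm => ?_⟩
    have := h (m + 1) (by simpa using hm)
    rwa [show lo + 1 + m = lo + (m + 1) by omega]

lemma PolySymbol.wordPath {r : ℕ+ → ℕ+ → Prop} (s : PolySymbol)
    (h : ∀ i : Fin s.depth, r (s.pt i.castSucc) (s.pt i.succ)) :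
    ∃ a b, WordPath r a (s.word R) b := by
  have hp : ∀ m (hm : m < s.depth + 1), s.pt (Fin.ofNat (s.depth + 1) m) = s.pt ⟨m, hm⟩ := by
    intro m hm
    congr 1
    exact Fin.ext (Nat.mod_eq_of_lt hm)
  have ha : Along r (fun m => s.pt (Fin.ofNat (s.depth + 1) m)) (fun m => MvPowerSeries.X m) 0
      (s.word R) := by
    refine along_of_getElem fun m hm => ?_
    have hm' : m < s.depth := by simpa using hm
    rw [PolySymbol.getElem_word s m hm hm']
    simp only [zero_add]
    rw [hp m (by omega), hp (m + 1) (by omega)]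
    exact ⟨List.cons_ne_nil _ _, ⟨rfl, h ⟨m, hm'⟩, rfl⟩, rfl⟩
  refine ⟨_, _, ?_, ha.isPath⟩
  intro x hx
  obtain ⟨m, hm, rfl⟩ := List.mem_iff_getElem.1 hx
  exact (ha.getElem m hm).1

lemma PolySymbol.isMonotoneWord (s : PolySymbol) : IsMonotoneWord (s.word R) := by
  rcases s.monotone with h | h
  · obtain ⟨a, b, h'⟩ := s.wordPath (R := R) (r := (· < ·)) fun i => h i.castSucc_lt_succ
    exact ⟨a, b, Or.inl h'⟩
  · obtain ⟨a, b, h'⟩ := s.wordPath (R := R) (r := (· > ·)) fun i => h i.castSucc_lt_succ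
    exact ⟨a, b, Or.inr h'⟩

/-- At the word of a symbol with the variables as arguments, the coefficients of `G` are the images
of the generators with those endpoints. -/
lemma algHom_ext_of_G {f g : HBar →ₐ[ℚ] R}
    (hlog : ∀ i, f (MvPolynomial.X (Gen.log i)) = g (MvPolynomial.X (Gen.log i)))
    (hG : ∀ w, IsMonotoneWord w → (symbCoeffs f).G w = (symbCoeffs g).G w) : f = g := by
  refine MvPolynomial.algHom_ext fun x => ?_
  cases x with
  | log i => exact hlog i
  | poly s =>
    have h := hG _ s.isMonotoneWord
    rw [s.G_word, s.G_word, evalSeries, evalSeries] at h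
    let e : Fin s.depth ↪ ℕ := Fin.valEmbedding
    have h' : MvPowerSeries.rename e (MvPowerSeries.map f.toRingHom (formalSeries s.pt)) =
        MvPowerSeries.rename e (MvPowerSeries.map g.toRingHom (formalSeries s.pt)) := by
      rw [MvPowerSeries.rename_eq_subst, MvPowerSeries.rename_eq_subst]
      exact h
    have h2 := congrArg (MvPowerSeries.coeff
      (Finsupp.equivFunOnFinite.symm fun r => (s.idx r).natPred))
      (MvPowerSeries.rename_injective e h')
    have h3 : MvPowerSeries.coeff (Finsupp.equivFunOnFinite.symm fun r => (s.idx r).natPred)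
        (formalSeries s.pt) = MvPolynomial.X (Gen.poly s) := by
      change formalSeries s.pt _ = _
      rw [formalSeries, bracket, dif_neg s.depth_pos.ne', dif_pos s.monotone]
      congr 2
      simp
    rw [MvPowerSeries.coeff_map, MvPowerSeries.coeff_map, h3] at h2
    exact h2

theorem convolve_assoc (f g h : HBar →ₐ[ℚ] R) :
    convolve (convolve f g) h = convolve f (convolve g h) :=
  algHom_ext_of_G (fun i => by simp only [convolve_X_log, add_assoc])
    fun _ hw => convolve_assoc_G f g h hw

variable (R) in
/-- The counit with values in an algebra. -/
noncomputable def counitHom : HBar →ₐ[ℚ] R := (Algebra.ofId ℚ R).comp counit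

lemma counitHom_X (x : Gen) : counitHom R (MvPolynomial.X x) = 0 := by
  simp [counitHom, counit]

lemma counitHom_log (y : Edges) : counitHom R y.log = 0 := by
  unfold Edges.log
  induction y.toList with
  | nil => simp
  | cons e l ih =>
    have : counitHom R (logSymbol e.1 e.2) = 0 := by simp [logSymbol, counitHom_X]
    simp [ih, this]

lemma symbCoeffs_counitHom_G {w : List (Edges × Arg R)} (hw : w ≠ []) :
    (symbCoeffs (counitHom R)).G w = 0 := by
  have hl : w.length ≠ 0 := by simpa using hw
  change evalSeries _ _ _ = 0
  have h : MvPowerSeries.map (counitHom R).toRingHom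
      (formalSeries fun m : Fin (w.length + 1) => endpoint w m) = MvPowerSeries.C 0 := by
    ext m
    rw [MvPowerSeries.coeff_map]
    change counitHom R (formalSeries _ m) = _
    rw [formalSeries, bracket, dif_neg hl]
    split_ifs
    · rw [counitHom_X]
      simp
    · simp
  rw [evalSeries, h, MvPowerSeries.subst_C, map_zero]

lemma symbCoeffs_counitHom_E (y : Edges) (s : Arg R) : (symbCoeffs (counitHom R)).E y s = 1 := by
  change evalExp _ _ _ = 1
  rw [evalExp, counitHom_log, map_zero, zero_mul, exp_subst_zero]

theorem convolve_counitHom (f : HBar →ₐ[ℚ] R) : convolve f (counitHom R) = f :=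
  algHom_ext_of_G (fun i => by rw [convolve_X_log, counitHom_X, add_zero]) fun w hw => by
    rw [symbCoeffs_convolve _ _ hw, coprodForm_unit_right _ (fun _ => symbCoeffs_counitHom_G)
      symbCoeffs_counitHom_E]

theorem counitHom_convolve (f : HBar →ₐ[ℚ] R) : convolve (counitHom R) f = f :=
  algHom_ext_of_G (fun i => by rw [convolve_X_log, counitHom_X, zero_add]) fun w hw => by
    rw [symbCoeffs_convolve _ _ hw, coprodForm_unit_left (Coeffs.G_nil _)
      fun _ => symbCoeffs_counitHom_G]

end Hom

/-! ### Coassociativity and counit laws -/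

section Bialgebra

/-- The universal case of `convolve_assoc`: for the three inclusions, the two bracketings are the
two iterated coproducts. -/
theorem comul_coassoc : (Algebra.TensorProduct.assoc ℚ ℚ ℚ HBar HBar HBar).toAlgHom.comp
      ((Algebra.TensorProduct.map comul (AlgHom.id ℚ HBar)).comp comul) =
    (Algebra.TensorProduct.map (AlgHom.id ℚ HBar) comul).comp comul := by
  let i1 : HBar →ₐ[ℚ] HBar ⊗[ℚ] (HBar ⊗[ℚ] HBar) := Algebra.TensorProduct.includeLeft
  let i2 : HBar →ₐ[ℚ] HBar ⊗[ℚ] (HBar ⊗[ℚ] HBar) :=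
    Algebra.TensorProduct.includeRight.comp Algebra.TensorProduct.includeLeft
  let i3 : HBar →ₐ[ℚ] HBar ⊗[ℚ] (HBar ⊗[ℚ] HBar) :=
    Algebra.TensorProduct.includeRight.comp Algebra.TensorProduct.includeRight
  have e1 : ∀ t : HBar ⊗[ℚ] HBar, Algebra.TensorProduct.productMap i1 i2 t =
      (Algebra.TensorProduct.assoc ℚ ℚ ℚ HBar HBar HBar).toAlgHom (t ⊗ₜ[ℚ] 1) := by
    intro t
    induction t with
    | zero => simp
    | tmul a b => simp [i1, i2]
    | add a b ha hb => rw [map_add, ha, hb, TensorProduct.add_tmul, map_add]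
  have e2 : ∀ t : HBar ⊗[ℚ] HBar,
      Algebra.TensorProduct.productMap i2 i3 t = (1 : HBar) ⊗ₜ[ℚ] t := by
    intro t
    induction t with
    | zero => simp
    | tmul a b => simp [i2, i3]
    | add a b ha hb => rw [map_add, ha, hb, TensorProduct.tmul_add]
  have h1 : ∀ t : HBar ⊗[ℚ] HBar, (Algebra.TensorProduct.assoc ℚ ℚ ℚ HBar HBar HBar).toAlgHom
      (Algebra.TensorProduct.map comul (AlgHom.id ℚ HBar) t) =
      Algebra.TensorProduct.productMap (convolve i1 i2) i3 t := by
    intro t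
    induction t with
    | zero => simp
    | tmul a b =>
      rw [Algebra.TensorProduct.productMap_apply_tmul, convolve, AlgHom.comp_apply, e1]
      have h : comul a ⊗ₜ[ℚ] b = (comul a ⊗ₜ[ℚ] (1 : HBar)) * (1 ⊗ₜ[ℚ] b) := by simp
      rw [Algebra.TensorProduct.map_tmul, AlgHom.id_apply, h, map_mul]
      congr 1
    | add a b ha hb => rw [map_add, map_add, map_add, ha, hb]
  have h2 : ∀ t : HBar ⊗[ℚ] HBar, Algebra.TensorProduct.productMap i1 (convolve i2 i3) t =
      Algebra.TensorProduct.map (AlgHom.id ℚ HBar) comul t := by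
    intro t
    induction t with
    | zero => simp
    | tmul a b =>
      rw [Algebra.TensorProduct.productMap_apply_tmul, convolve, AlgHom.comp_apply, e2]
      simp [i1]
    | add a b ha hb => rw [map_add, map_add, ha, hb]
  refine AlgHom.ext fun x => ?_
  have := DFunLike.congr_fun (convolve_assoc (R := HBar ⊗[ℚ] (HBar ⊗[ℚ] HBar)) i1 i2 i3) x
  simp only [convolve, AlgHom.comp_apply] at this h1 h2 ⊢
  rw [← h2, ← this, h1]

/-- This is `counitHom_convolve` for the identity character, read through the isomorphism `ℚ ⊗ HBar
≃ HBar`. -/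
theorem rTensor_counit : (Algebra.TensorProduct.map counit (AlgHom.id ℚ HBar)).comp comul =
    (Algebra.TensorProduct.lid ℚ HBar).symm := by
  have h : (Algebra.TensorProduct.lid ℚ HBar).toAlgHom.comp
      (Algebra.TensorProduct.map counit (AlgHom.id ℚ HBar)) =
      Algebra.TensorProduct.productMap (counitHom HBar) (AlgHom.id ℚ HBar) := by
    refine Algebra.TensorProduct.ext' fun a b => ?_
    simp [counitHom, Algebra.ofId_apply, Algebra.smul_def]
  refine AlgHom.ext fun x => ?_
  refine (Algebra.TensorProduct.lid ℚ HBar).injective ?_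
  have h1 := DFunLike.congr_fun h (comul x)
  have h2 := DFunLike.congr_fun (counitHom_convolve (AlgHom.id ℚ HBar)) x
  simp only [convolve, AlgHom.comp_apply] at h1 h2
  rw [← h1] at h2
  simpa using h2

theorem lTensor_counit : (Algebra.TensorProduct.map (AlgHom.id ℚ HBar) counit).comp comul =
    (Algebra.TensorProduct.rid ℚ ℚ HBar).symm := by
  have h : (Algebra.TensorProduct.rid ℚ ℚ HBar).toAlgHom.comp
      (Algebra.TensorProduct.map (AlgHom.id ℚ HBar) counit) =
      Algebra.TensorProduct.productMap (AlgHom.id ℚ HBar) (counitHom HBar) := by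
    refine Algebra.TensorProduct.ext' fun a b => ?_
    simp [counitHom, Algebra.ofId_apply, Algebra.smul_def, mul_comm]
  refine AlgHom.ext fun x => ?_
  refine (Algebra.TensorProduct.rid ℚ ℚ HBar).injective ?_
  have h1 := DFunLike.congr_fun h (comul x)
  have h2 := DFunLike.congr_fun (convolve_counitHom (AlgHom.id ℚ HBar)) x
  simp only [convolve, AlgHom.comp_apply] at h1 h2
  rw [← h1] at h2
  simpa using h2

end Bialgebra

/-! ### The weight grading on the algebra and its tensor square -/

section Weight

instance gradedMonoid_wt : SetLike.GradedMonoid wt :=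
  MvPolynomial.WeightedHomogeneousSubmodule.gradedMonoid

lemma Gen.weight_ne_zero (x : Gen) : x.weight ≠ 0 := by
  cases x with
  | log i => exact one_ne_zero
  | poly s =>
    have : Nonempty (Fin s.depth) := ⟨⟨0, s.depth_pos⟩⟩
    exact (Finset.sum_pos (fun r _ => (s.idx r).pos) Finset.univ_nonempty).ne'

lemma X_mem_wt (x : Gen) : (MvPolynomial.X x : HBar) ∈ wt x.weight :=
  MvPolynomial.isWeightedHomogeneous_X ℚ _ x

/-- Every generator has positive weight, so a monomial of weight zero is constant. -/
lemma wt_zero : wt 0 = LinearMap.range (Algebra.linearMap ℚ HBar) := by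
  classical
  refine le_antisymm (fun x hx => ?_) ?_
  · refine ⟨x.coeff 0, ?_⟩
    have hw : MvPolynomial.NonTorsionWeight Gen.weight :=
      MvPolynomial.nonTorsionWeight_of Gen.weight_ne_zero
    ext m
    rw [Algebra.linearMap_apply, MvPolynomial.algebraMap_eq, MvPolynomial.coeff_C]
    split_ifs with h
    · rw [h]
    · by_contra hne
      refine h (Finsupp.ext fun y => ?_)
      have := (MvPolynomial.weightedDegree_eq_zero_iff hw).1 (hx (Ne.symm hne)) y
      rw [this, Finsupp.zero_apply]
  · rintro _ ⟨c, rfl⟩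
    exact MvPolynomial.isWeightedHomogeneous_C _ c

lemma isInternal_wt : DirectSum.IsInternal wt :=
  letI := MvPolynomial.weightedDecomposition ℚ Gen.weight
  DirectSum.Decomposition.isInternal wt

/-- An algebra map which maps each generator to an element of its weight respects the weight. -/
lemma algHom_mem_of_mem_wt {B : Type*} [CommRing B] [Algebra ℚ B] (𝓑 : ℕ → Submodule ℚ B)
    [SetLike.GradedMonoid 𝓑] (φ : HBar →ₐ[ℚ] B)
    (h : ∀ x : Gen, φ (MvPolynomial.X x) ∈ 𝓑 x.weight) {n : ℕ} {a : HBar} (ha : a ∈ wt n) :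
    φ a ∈ 𝓑 n := by
  have hm : ∀ m : Gen →₀ ℕ, φ (MvPolynomial.monomial m 1) ∈ 𝓑 (Finsupp.weight Gen.weight m) := by
    intro m
    induction m using Finsupp.induction_linear with
    | zero =>
      rw [MvPolynomial.monomial_zero', map_one, map_one, map_zero]
      exact SetLike.GradedOne.one_mem
    | add m m' hm hm' =>
      rw [← one_mul (1 : ℚ), ← MvPolynomial.monomial_mul, map_mul, map_add]
      exact SetLike.mul_mem_graded hm hm'
    | single x k =>
      rw [← MvPolynomial.X_pow_eq_monomial, map_pow, Finsupp.weight_single]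
      exact SetLike.pow_mem_graded k (h x)
  rw [a.as_sum, map_sum]
  refine Submodule.sum_mem _ fun m hms => ?_
  rw [← mul_one (a.coeff m), ← smul_eq_mul, ← MvPolynomial.smul_monomial, map_smul]
  refine Submodule.smul_mem _ _ ?_
  rw [← ha (MvPolynomial.mem_support_iff.1 hms)]
  exact hm m

lemma counit_eq_zero {n : ℕ} (hn : n ≠ 0) {a : HBar} (ha : a ∈ wt n) : counit a = 0 := by
  rw [counit, MvPolynomial.aeval_zero', MvPolynomial.constantCoeff_eq,
    MvPolynomial.IsWeightedHomogeneous.coeff_eq_zero ha _ (by simpa using hn.symm), map_zero]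

lemma wtTensor_eq_span (n : ℕ) : wtTensor n = Submodule.span ℚ
    {t | ∃ p q, p + q = n ∧ ∃ a ∈ wt p, ∃ b ∈ wt q, a ⊗ₜ[ℚ] b = t} := by
  refine le_antisymm (iSup₂_le fun pq hpq => ?_) (Submodule.span_le.2 ?_)
  · rintro _ ⟨t, rfl⟩
    induction t with
    | zero => simp
    | tmul a b =>
      exact Submodule.subset_span ⟨pq.1, pq.2, Finset.HasAntidiagonal.mem_antidiagonal.1 hpq, a, a.2, b, b.2, rfl⟩
    | add a b ha hb => rw [map_add]; exact Submodule.add_mem _ ha hb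
  · rintro _ ⟨p, q, hpq, a, ha, b, hb, rfl⟩
    exact Submodule.mem_iSup_of_mem (p, q) (Submodule.mem_iSup_of_mem
      (Finset.HasAntidiagonal.mem_antidiagonal.2 hpq) ⟨(⟨a, ha⟩ : wt p) ⊗ₜ (⟨b, hb⟩ : wt q), rfl⟩)

lemma tmul_mem_wtTensor {p q : ℕ} {a b : HBar} (ha : a ∈ wt p) (hb : b ∈ wt q) :
    a ⊗ₜ[ℚ] b ∈ wtTensor (p + q) := by
  rw [wtTensor_eq_span]
  exact Submodule.subset_span ⟨p, q, rfl, a, ha, b, hb, rfl⟩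

instance gradedMonoid_wtTensor : SetLike.GradedMonoid wtTensor where
  one_mem := tmul_mem_wtTensor (p := 0) (q := 0) SetLike.GradedOne.one_mem
    SetLike.GradedOne.one_mem
  mul_mem := by
    intro m n x y hx hy
    have h : wtTensor m * wtTensor n ≤ wtTensor (m + n) := by
      rw [wtTensor_eq_span m, wtTensor_eq_span n, Submodule.span_mul_span, Submodule.span_le]
      rintro _ ⟨_, ⟨p, q, rfl, a, ha, b, hb, rfl⟩, _, ⟨p', q', rfl, a', ha', b', hb', rfl⟩, rfl⟩
      change (a ⊗ₜ[ℚ] b) * (a' ⊗ₜ[ℚ] b') ∈ wtTensor _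
      rw [Algebra.TensorProduct.tmul_mul_tmul, add_add_add_comm]
      exact tmul_mem_wtTensor (SetLike.mul_mem_graded ha ha') (SetLike.mul_mem_graded hb hb')
    exact h (Submodule.mul_mem_mul hx hy)

lemma tmul_one_mem_wtTensor {n : ℕ} {a : HBar} (ha : a ∈ wt n) : a ⊗ₜ[ℚ] 1 ∈ wtTensor n :=
  tmul_mem_wtTensor (q := 0) ha SetLike.GradedOne.one_mem

lemma one_tmul_mem_wtTensor {n : ℕ} {a : HBar} (ha : a ∈ wt n) : 1 ⊗ₜ[ℚ] a ∈ wtTensor n := by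
  rw [← zero_add n]
  exact tmul_mem_wtTensor SetLike.GradedOne.one_mem ha

end Weight

/-! ### The coproduct respects the weight -/

section SeriesWeight

variable {B : Type} [CommRing B] [Algebra ℚ B] (𝓑 : ℕ → Submodule ℚ B)

/-- A series whose coefficients at the monomials of degree `e` have weight `e + k`. -/
def HasWeight (k : ℕ) (F : Ser B) : Prop :=
  ∀ e : ℕ →₀ ℕ, MvPowerSeries.coeff e F ∈ 𝓑 (e.degree + k)

variable {𝓑}

lemma HasWeight.sum {k : ℕ} {ι : Type*} {s : Finset ι} {F : ι → Ser B}
    (h : ∀ i ∈ s, HasWeight 𝓑 k (F i)) : HasWeight 𝓑 k (∑ i ∈ s, F i) := fun e => by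
  rw [map_sum]
  exact Submodule.sum_mem _ fun i hi => h i hi e

lemma HasWeight.neg {k : ℕ} {F : Ser B} (h : HasWeight 𝓑 k F) : HasWeight 𝓑 k (-F) := fun e => by
  rw [map_neg]
  exact Submodule.neg_mem _ (h e)

lemma HasWeight.map {C : Type} [CommRing C] [Algebra ℚ C] {𝓒 : ℕ → Submodule ℚ C} (φ : B →+* C)
    (hφ : ∀ n, ∀ b ∈ 𝓑 n, φ b ∈ 𝓒 n) {k : ℕ} {F : Ser B} (h : HasWeight 𝓑 k F) :
    HasWeight 𝓒 k (MvPowerSeries.map φ F) := fun e => by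
  rw [MvPowerSeries.coeff_map]
  exact hφ _ _ (h e)

variable [SetLike.GradedMonoid 𝓑]

lemma hasWeight_one : HasWeight 𝓑 0 (1 : Ser B) := fun e => by
  classical
  rw [MvPowerSeries.coeff_one]
  split_ifs with h
  · rw [h, map_zero]
    exact SetLike.one_mem_graded 𝓑
  · exact Submodule.zero_mem _

lemma HasWeight.mul {k l : ℕ} {F G : Ser B} (hF : HasWeight 𝓑 k F) (hG : HasWeight 𝓑 l G) :
    HasWeight 𝓑 (k + l) (F * G) := fun e => by
  classical
  rw [MvPowerSeries.coeff_mul]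
  refine Submodule.sum_mem _ fun x hx => ?_
  rw [← Finset.HasAntidiagonal.mem_antidiagonal.1 hx, map_add, add_add_add_comm]
  exact SetLike.mul_mem_graded (hF _) (hG _)

lemma HasWeight.pow_zero {F : Ser B} (hF : HasWeight 𝓑 0 F) (n : ℕ) : HasWeight 𝓑 0 (F ^ n) := by
  induction n with
  | zero => rw [_root_.pow_zero]; exact hasWeight_one
  | succ n ih => rw [pow_succ]; exact ih.mul hF

lemma HasWeight.prod {ι : Type*} {s : Finset ι} {F : ι → Ser B} {k : ι → ℕ}
    (h : ∀ i ∈ s, HasWeight 𝓑 (k i) (F i)) : HasWeight 𝓑 (∑ i ∈ s, k i) (∏ i ∈ s, F i) := by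
  classical
  induction s using Finset.induction_on with
  | empty => rw [Finset.sum_empty, Finset.prod_empty]; exact hasWeight_one
  | insert a s ha ih =>
    rw [Finset.sum_insert ha, Finset.prod_insert ha]
    exact (h a (Finset.mem_insert_self a s)).mul
      (ih fun i hi => h i (Finset.mem_insert_of_mem hi))

/-- A series with rational coefficients which is a homogeneous polynomial of degree one. -/
def IsLinear (s : Ser HBar) : Prop :=
  ∃ q : MvPolynomial ℕ ℚ, q.IsHomogeneous 1 ∧
    s = MvPowerSeries.map (algebraMap ℚ HBar) (q : MvPowerSeries ℕ ℚ)

lemma isLinear_tVar (b : ℕ) : IsLinear (tVar b) :=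
  ⟨MvPolynomial.X b, MvPolynomial.isHomogeneous_X _ _, by simp⟩

lemma isLinear_tVar_sub_tVar (b c : ℕ) : IsLinear (tVar b - tVar c) :=
  ⟨MvPolynomial.X b - MvPolynomial.X c,
    (MvPolynomial.isHomogeneous_X _ _).sub (MvPolynomial.isHomogeneous_X _ _), by
      have h : ((MvPolynomial.X b - MvPolynomial.X c : MvPolynomial ℕ ℚ) : MvPowerSeries ℕ ℚ) =
        MvPowerSeries.X b - MvPowerSeries.X c := by
        rw [← MvPolynomial.coeToMvPowerSeries.ringHom_apply, map_sub]
        simp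
      rw [h, map_sub, MvPowerSeries.map_X, MvPowerSeries.map_X]⟩

lemma IsLinear.constantCoeff {s : Ser HBar} (hs : IsLinear s) :
    MvPowerSeries.constantCoeff s = 0 := by
  obtain ⟨q, hq, rfl⟩ := hs
  rw [MvPowerSeries.constantCoeff_map, ← MvPowerSeries.coeff_zero_eq_constantCoeff_apply,
    MvPolynomial.coeff_coe, hq.coeff_eq_zero (by simp), map_zero]

lemma bracket_mem_wt {k : ℕ} (p : Fin (k + 1) → ℕ+) (n : Fin k → ℕ+) :
    bracket p n ∈ wt (∑ r, (n r : ℕ)) := by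
  unfold bracket
  split_ifs with hk hp
  · subst hk
    exact SetLike.GradedOne.one_mem
  · exact X_mem_wt _
  · exact Submodule.zero_mem _

/-- The coefficient at `m` has indices `m r + 1`, hence weight the degree of `m` plus `k`, and
substituting linear forms preserves the degree. -/
lemma hasWeight_genSeries {k : ℕ} (p : Fin (k + 1) → ℕ+) {s : Fin k → Ser HBar}
    (hs : ∀ r, IsLinear (s r)) : HasWeight wt k (genSeries p s) := fun e => by
  rw [genSeries, MvPowerSeries.coeff_subst
    (MvPowerSeries.hasSubst_of_constantCoeff_zero fun r => (hs r).constantCoeff)]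
  refine finsum_induction (· ∈ wt _) (Submodule.zero_mem _)
    (fun _ _ => Submodule.add_mem _) fun m => ?_
  choose q hq hsq using hs
  have hP : (∏ r, q r ^ m r).IsHomogeneous (∑ r, m r) := by
    have := MvPolynomial.IsHomogeneous.prod Finset.univ (fun r => q r ^ m r) (fun r => 1 * m r)
      fun r _ => (hq r).pow (m r)
    simpa using this
  have he : (m.prod fun r l => s r ^ l) = MvPowerSeries.map (algebraMap ℚ HBar)
      ((∏ r, q r ^ m r : MvPolynomial ℕ ℚ) : MvPowerSeries ℕ ℚ) := by
    rw [Finsupp.prod_fintype _ _ fun r => pow_zero _]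
    simp only [hsq, ← MvPolynomial.coeToMvPowerSeries.ringHom_apply, map_prod, map_pow]
  rw [he, MvPowerSeries.coeff_map, MvPolynomial.coeff_coe]
  by_cases h0 : MvPolynomial.coeff e (∏ r, q r ^ m r) = 0
  · rw [h0, map_zero, smul_zero]
    exact Submodule.zero_mem _
  · rw [smul_eq_mul, mul_comm, ← Algebra.smul_def]
    refine Submodule.smul_mem _ _ ?_
    have hd : e.degree + k = ∑ r, ((m r).succPNat : ℕ) := by
      have hd := hP h0
      simp only [Nat.succPNat_coe, Nat.succ_eq_add_one, Finset.sum_add_distrib, ← hd,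
        Finsupp.degree_eq_weight_one, Finset.sum_const, Finset.card_univ, Fintype.card_fin,
        smul_eq_mul, mul_one]
      rfl
    rw [hd]
    exact bracket_mem_wt _ _

lemma logSymbol_mem_wt (a b : ℕ+) : logSymbol a b ∈ wt 1 :=
  Submodule.sub_mem _ (Submodule.sum_mem _ fun r _ => X_mem_wt (Gen.log r))
    (Submodule.sum_mem _ fun r _ => X_mem_wt (Gen.log r))

/-- A weight-one element times a variable has weight equal to degree, and so have its powers. -/
lemma hasWeight_expSeries {a : HBar} (ha : a ∈ wt 1) (b : ℕ) :
    HasWeight wt 0 (expSeries a (tVar b)) := fun e => by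
  have h : HasWeight wt 0 (MvPowerSeries.C a * tVar b) := fun e => by
    classical
    rw [MvPowerSeries.coeff_C_mul, MvPowerSeries.coeff_X]
    split_ifs with h
    · rw [h, Finsupp.degree_single, mul_one]
      exact ha
    · rw [mul_zero]
      exact Submodule.zero_mem _
  rw [expSeries, PowerSeries.coeff_subst (hasSubst_of_constantCoeff (by simp))]
  exact finsum_induction (· ∈ wt _) (Submodule.zero_mem _)
    (fun _ _ => Submodule.add_mem _) fun d => Submodule.smul_mem _ _ (h.pow_zero d e)

lemma hasWeight_block (p : ℕ → ℕ+) {a b c : ℕ} (hab : a ≤ b) (hbc : b < c) :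
    HasWeight wt (c - a - 1) (block p a b c) := by
  have hc : c - a - 1 = 0 + 0 + (b - a) + (c - 1 - b) := by omega
  rw [hc, block]
  exact ((((hasWeight_one.neg).pow_zero _).mul
    (hasWeight_expSeries (logSymbol_mem_wt _ _) _)).mul
    (hasWeight_genSeries _ fun r => isLinear_tVar_sub_tVar _ _)).mul
    (hasWeight_genSeries _ fun r => isLinear_tVar_sub_tVar _ _)

/-- Counts the `d` letters: one marked letter in each of the `k` blocks, the prefix, and the
unmarked letters of the blocks. These are the offsets of the factors of a term of the coproduct. -/
lemma sum_upper {d k : ℕ} {i j : Fin k → Fin d} (h : (i, j) ∈ interleaved d k) :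
    k + (upper i 0 + ∑ α : Fin k, (upper i (α + 1) - i α - 1)) = d := by
  have hi : ∀ α : Fin k, (i α : ℕ) = upper i α := fun α => by simp [upper]
  have hlt : ∀ m < k, upper i m < upper i (m + 1) := fun m hm => by
    have h1 := lt_upper_succ h ⟨m, hm⟩
    have h2 : (i ⟨m, hm⟩ : ℕ) ≤ j ⟨m, hm⟩ := (Finset.mem_filter.1 h).2.1 ⟨m, hm⟩
    rw [hi] at h2
    exact h2.trans_lt h1
  have hs : ∀ m ≤ k, m + (upper i 0 +
      ∑ α ∈ Finset.range m, (upper i (α + 1) - upper i α - 1)) = upper i m := by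
    intro m hm
    induction m with
    | zero => simp
    | succ m ih =>
      have := ih (by omega)
      have := hlt m (by omega)
      rw [Finset.sum_range_succ]
      omega
  have h3 : upper i k = d := by simp [upper]
  simp only [hi]
  rw [← Finset.sum_range (fun α => upper i (α + 1) - upper i α - 1), hs k le_rfl, h3]

lemma hasWeight_coproductTerm (p : ℕ → ℕ+) {d k : ℕ} {i j : Fin k → Fin d}
    (h : (i, j) ∈ interleaved d k) : HasWeight wtTensor d (coproductTerm p i j) := by
  have h1 := (hasWeight_genSeries (fun r => p (upper i (r : ℕ)))
    (fun r : Fin k => isLinear_tVar (j r : ℕ))).map (𝓒 := wtTensor)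
    (Algebra.TensorProduct.includeLeft : HBar →ₐ[ℚ] HBar ⊗[ℚ] HBar).toRingHom
    fun n b hb => tmul_one_mem_wtTensor hb
  have h2 := (((hasWeight_genSeries (fun r : Fin (upper i 0 + 1) => p (r : ℕ))
    (fun r : Fin (upper i 0) => isLinear_tVar (r : ℕ))).mul
    (HasWeight.prod (s := Finset.univ) fun (α : Fin k) _ => hasWeight_block p
      ((Finset.mem_filter.1 h).2.1 α) (lt_upper_succ h α)))).map (𝓒 := wtTensor)
    (Algebra.TensorProduct.includeRight : HBar →ₐ[ℚ] HBar ⊗[ℚ] HBar).toRingHom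
    fun n b hb => one_tmul_mem_wtTensor hb
  have h3 := h1.mul h2
  rw [sum_upper h] at h3
  exact h3

lemma comulGen_mem_wtTensor (x : Gen) : comulGen x ∈ wtTensor x.weight := by
  cases x with
  | log i =>
    exact Submodule.add_mem _ (tmul_one_mem_wtTensor (X_mem_wt (Gen.log i)))
      (one_tmul_mem_wtTensor (X_mem_wt (Gen.log i)))
  | poly s =>
    have h : HasWeight wtTensor s.depth
        (coproductSeries (fun m => s.pt (Fin.ofNat (s.depth + 1) m)) s.depth) :=
      HasWeight.sum fun k _ => HasWeight.sum fun ij hij => hasWeight_coproductTerm _ hij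
    have h1 := h (∑ r : Fin s.depth, Finsupp.single (r : ℕ) ((s.idx r : ℕ) - 1))
    have h2 : (∑ r : Fin s.depth, Finsupp.single (r : ℕ) ((s.idx r : ℕ) - 1)).degree + s.depth =
        ∑ r, (s.idx r : ℕ) := by
      rw [map_sum]
      simp only [Finsupp.degree_single]
      have h3 : ∑ r : Fin s.depth, (((s.idx r : ℕ) - 1) + 1) = ∑ r, (s.idx r : ℕ) :=
        Finset.sum_congr rfl fun r _ => Nat.sub_add_cancel (s.idx r).pos
      rw [← h3, Finset.sum_add_distrib]
      simp
    rw [h2] at h1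
    exact h1

theorem comul_mem_wtTensor {n : ℕ} {a : HBar} (ha : a ∈ wt n) : comul a ∈ wtTensor n :=
  algHom_mem_of_mem_wt wtTensor comul (fun x => by
    rw [comul, MvPolynomial.aeval_X]; exact comulGen_mem_wtTensor x) ha

end SeriesWeight

/-! ### The antipode of a connected graded bialgebra -/

section Antipode

open TensorProduct WithConv

/-- The sum of the products of the graded pieces with total weight `n`. -/
def gradedTensor {K A : Type*} [Field K] [Ring A] [Algebra K A] (𝓐 : ℕ → Submodule K A) (n : ℕ) :
    Submodule K (A ⊗[K] A) :=
  ⨆ ab ∈ Finset.HasAntidiagonal.antidiagonal n,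
    LinearMap.range (TensorProduct.map (𝓐 ab.1).subtype (𝓐 ab.2).subtype)

variable {K A : Type*} [Field K] [Ring A] [Bialgebra K A]

lemma gradedTensor_induction {𝓐 : ℕ → Submodule K A} {n : ℕ} {P : A ⊗[K] A → Prop} (h0 : P 0)
    (hadd : ∀ s t, P s → P t → P (s + t))
    (ht : ∀ p q, p + q = n → ∀ a ∈ 𝓐 p, ∀ b ∈ 𝓐 q, P (a ⊗ₜ b)) {t : A ⊗[K] A}
    (h : t ∈ gradedTensor 𝓐 n) : P t := by
  induction h using Submodule.iSup_induction' with
  | zero => exact h0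
  | add s t _ _ hs ht => exact hadd s t hs ht
  | mem pq t h =>
    induction h using Submodule.iSup_induction' with
    | zero => exact h0
    | add s t _ _ hs ht => exact hadd s t hs ht
    | mem hpq t h =>
      obtain ⟨t, rfl⟩ := h
      induction t with
      | zero => rw [map_zero]; exact h0
      | add s t hs ht => rw [map_add]; exact hadd _ _ hs ht
      | tmul a b =>
        exact ht _ _ (Finset.HasAntidiagonal.mem_antidiagonal.1 hpq) a a.2 b b.2

/-- A grading of a bialgebra by submodules, with one-dimensional weight zero part. -/
structure IsConnectedGrading (𝓐 : ℕ → Submodule K A) : Prop where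
  gradedMonoid : SetLike.GradedMonoid 𝓐
  zero_eq : 𝓐 0 = LinearMap.range (Algebra.linearMap K A)
  comul_mem : ∀ n, ∀ a ∈ 𝓐 n, Coalgebra.comul (R := K) a ∈ gradedTensor 𝓐 n
  counit_eq_zero : ∀ n, n ≠ 0 → ∀ a ∈ 𝓐 n, Coalgebra.counit (R := K) a = 0

namespace IsConnectedGrading

variable {𝓐 : ℕ → Submodule K A}

lemma convMul_mem (h𝓐 : IsConnectedGrading 𝓐) {f g : WithConv (A →ₗ[K] A)}
    (hf : ∀ n, ∀ a ∈ 𝓐 n, f a ∈ 𝓐 n) (hg : ∀ n, ∀ a ∈ 𝓐 n, g a ∈ 𝓐 n) (n : ℕ) (a : A)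
    (ha : a ∈ 𝓐 n) : (f * g) a ∈ 𝓐 n := by
  have := h𝓐.gradedMonoid
  rw [LinearMap.convMul_apply]
  refine gradedTensor_induction (P := fun t => LinearMap.mul' K A (map f.ofConv g.ofConv t) ∈ 𝓐 n)
    (by simp) (fun s t hs ht => by rw [map_add, map_add]; exact Submodule.add_mem _ hs ht) ?_
    (h𝓐.comul_mem n a ha)
  rintro p q rfl a ha b hb
  exact SetLike.mul_mem_graded (hf p a ha) (hg q b hb)

/-- A convolution on weight `n` only sees its factors on weights adding up to `n`, so they may be
replaced weight by weight. -/
lemma convMul_congr (h𝓐 : IsConnectedGrading 𝓐) {f f' g g' : WithConv (A →ₗ[K] A)} {n : ℕ}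
    (h : ∀ p q, p + q = n → ∀ a ∈ 𝓐 p, ∀ b ∈ 𝓐 q, f a * g b = f' a * g' b) {a : A}
    (ha : a ∈ 𝓐 n) : (f * g) a = (f' * g') a := by
  rw [LinearMap.convMul_apply, LinearMap.convMul_apply]
  refine gradedTensor_induction (P := fun t => LinearMap.mul' K A (map f.ofConv g.ofConv t) =
    LinearMap.mul' K A (map f'.ofConv g'.ofConv t)) (by simp)
    (fun s t hs ht => by simp only [map_add, hs, ht]) ?_ (h𝓐.comul_mem n a ha)
  exact h

lemma convOne_mem (h𝓐 : IsConnectedGrading 𝓐) (n : ℕ) (a : A) (ha : a ∈ 𝓐 n) :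
    (1 : WithConv (A →ₗ[K] A)) a ∈ 𝓐 n := by
  rw [LinearMap.convOne_apply]
  by_cases hn : n = 0
  · rw [hn, h𝓐.zero_eq]
    exact ⟨_, rfl⟩
  · rw [h𝓐.counit_eq_zero n hn a ha, map_zero]
    exact Submodule.zero_mem _

variable (K A) in
/-- The convolution unit minus the identity. -/
noncomputable def unitSubId : WithConv (A →ₗ[K] A) := 1 - toConv LinearMap.id

lemma unitSubId_apply (a : A) : unitSubId K A a = (1 : WithConv (A →ₗ[K] A)) a - a := rfl

lemma unitSubId_pow_mem (h𝓐 : IsConnectedGrading 𝓐) (k n : ℕ) (a : A) (ha : a ∈ 𝓐 n) :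
    (unitSubId K A ^ k) a ∈ 𝓐 n := by
  induction k generalizing n a with
  | zero => rw [pow_zero]; exact h𝓐.convOne_mem n a ha
  | succ k ih =>
    rw [pow_succ]
    refine h𝓐.convMul_mem ih (fun n a ha => ?_) n a ha
    rw [unitSubId_apply]
    exact Submodule.sub_mem _ (h𝓐.convOne_mem n a ha) ha

lemma unitSubId_eq_zero (h𝓐 : IsConnectedGrading 𝓐) {a : A} (ha : a ∈ 𝓐 0) :
    unitSubId K A a = 0 := by
  rw [h𝓐.zero_eq] at ha
  obtain ⟨c, rfl⟩ := ha
  rw [unitSubId_apply, LinearMap.convOne_apply, Algebra.linearMap_apply,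
    Bialgebra.counit_algebraMap, sub_self]

/-- In each component of the coproduct either the right weight is zero, and the last factor vanishes
there, or the left weight has dropped, and induction applies to the remaining power. -/
lemma unitSubId_pow_eq_zero (h𝓐 : IsConnectedGrading 𝓐) {k n : ℕ} (hn : n < k) {a : A}
    (ha : a ∈ 𝓐 n) : (unitSubId K A ^ k) a = 0 := by
  induction k generalizing n a with
  | zero => omega
  | succ k ih =>
    rw [pow_succ, h𝓐.convMul_congr (f' := 0) (g' := 0) _ ha, zero_mul]
    · rfl
    rintro p q rfl a ha b hb
    by_cases hq : q = 0
    · subst hq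
      rw [h𝓐.unitSubId_eq_zero hb, mul_zero]
      exact (mul_zero _).symm
    · rw [ih (by omega) ha, zero_mul]
      exact (mul_zero _).symm

variable (K A) in
/-- The partial sums of the geometric series which inverts the identity under convolution. -/
noncomputable def partialAntipode (n : ℕ) : WithConv (A →ₗ[K] A) :=
  ∑ i ∈ Finset.range (n + 1), unitSubId K A ^ i

lemma partialAntipode_apply (n : ℕ) (a : A) :
    partialAntipode K A n a = ∑ i ∈ Finset.range (n + 1), (unitSubId K A ^ i) a := by
  change (partialAntipode K A n).ofConv a = _
  rw [partialAntipode, ofConv_sum, LinearMap.sum_apply]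

lemma partialAntipode_eq (h𝓐 : IsConnectedGrading 𝓐) {m n : ℕ} (hmn : m ≤ n) {a : A}
    (ha : a ∈ 𝓐 m) : partialAntipode K A n a = partialAntipode K A m a := by
  rw [partialAntipode_apply, partialAntipode_apply]
  refine (Finset.sum_subset (Finset.range_mono (by omega)) fun i _ hi => ?_).symm
  exact h𝓐.unitSubId_pow_eq_zero (by simpa using hi) ha

variable (𝓐) in
/-- The antipode of a connected graded bialgebra. -/
noncomputable def antipode [DirectSum.Decomposition 𝓐] : A →ₗ[K] A :=
  DirectSum.toModule K ℕ A (fun n => (partialAntipode K A n).ofConv ∘ₗ (𝓐 n).subtype) ∘ₗ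
    (DirectSum.decomposeLinearEquiv 𝓐).toLinearMap

lemma antipode_apply [DirectSum.Decomposition 𝓐] {n : ℕ} {a : A} (ha : a ∈ 𝓐 n) :
    antipode 𝓐 a = partialAntipode K A n a := by
  rw [antipode, LinearMap.comp_apply, LinearEquiv.coe_coe, DirectSum.decomposeLinearEquiv_apply,
    DirectSum.decompose_of_mem 𝓐 ha]
  exact DirectSum.toModule_lof (M := fun n => 𝓐 n) K n ⟨a, ha⟩

lemma antipode_mem [DirectSum.Decomposition 𝓐] (h𝓐 : IsConnectedGrading 𝓐) {n : ℕ} {a : A}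
    (ha : a ∈ 𝓐 n) : antipode 𝓐 a ∈ 𝓐 n := by
  rw [antipode_apply ha, partialAntipode_apply]
  exact Submodule.sum_mem _ fun i _ => h𝓐.unitSubId_pow_mem i n a ha

lemma toConv_id_eq : toConv (LinearMap.id : A →ₗ[K] A) = 1 - unitSubId K A :=
  (sub_sub_cancel _ _).symm

lemma convExt [DirectSum.Decomposition 𝓐] {f g : WithConv (A →ₗ[K] A)}
    (h : ∀ n, ∀ a ∈ 𝓐 n, f a = g a) : f = g := by
  refine congrArg toConv (a₁ := f.ofConv) (a₂ := g.ofConv) (LinearMap.ext fun a => ?_)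
  induction a using DirectSum.Decomposition.inductionOn 𝓐 with
  | zero => rw [map_zero, map_zero]
  | homogeneous a => exact h _ a a.2
  | add a b ha hb => rw [map_add, map_add, ha, hb]

/-- On weight `n` the antipode may be replaced by the partial sum up to `n`, and the telescoping
geometric sum leaves `1` minus a power that vanishes in this weight. -/
lemma antipode_convMul_id [DirectSum.Decomposition 𝓐] (h𝓐 : IsConnectedGrading 𝓐) :
    toConv (antipode 𝓐) * toConv LinearMap.id = 1 := by
  refine convExt (𝓐 := 𝓐) fun n a ha => ?_
  have h1 := h𝓐.convMul_congr (f := toConv (antipode 𝓐)) (f' := partialAntipode K A n)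
    (g := toConv LinearMap.id) (g' := toConv LinearMap.id) (a := a) (by
    rintro p q rfl a ha b hb
    rw [h𝓐.partialAntipode_eq (Nat.le_add_right p q) ha, ← antipode_apply ha]) ha
  rw [h1, toConv_id_eq, partialAntipode, geom_sum_mul_neg]
  change (1 : WithConv (A →ₗ[K] A)) a - (unitSubId K A ^ (n + 1)) a = _
  rw [h𝓐.unitSubId_pow_eq_zero (Nat.lt_succ_self n) ha, sub_zero]

lemma id_convMul_antipode [DirectSum.Decomposition 𝓐] (h𝓐 : IsConnectedGrading 𝓐) :
    toConv LinearMap.id * toConv (antipode 𝓐) = 1 := by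
  refine convExt (𝓐 := 𝓐) fun n a ha => ?_
  have h1 := h𝓐.convMul_congr (f := toConv LinearMap.id) (f' := toConv LinearMap.id)
    (g := toConv (antipode 𝓐)) (g' := partialAntipode K A n) (a := a) (by
    rintro p q rfl a ha b hb
    rw [h𝓐.partialAntipode_eq (Nat.le_add_left q p) hb, ← antipode_apply hb]) ha
  rw [h1, toConv_id_eq, partialAntipode, mul_neg_geom_sum]
  change (1 : WithConv (A →ₗ[K] A)) a - (unitSubId K A ^ (n + 1)) a = _
  rw [h𝓐.unitSubId_pow_eq_zero (Nat.lt_succ_self n) ha, sub_zero]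

/-- A connected graded bialgebra is a Hopf algebra. -/
noncomputable abbrev hopfAlgebra [DirectSum.Decomposition 𝓐] (h𝓐 : IsConnectedGrading 𝓐) :
    HopfAlgebra K A where
  antipode := antipode 𝓐
  mul_antipode_rTensor_comul := congrArg ofConv h𝓐.antipode_convMul_id
  mul_antipode_lTensor_comul := congrArg ofConv h𝓐.id_convMul_antipode

end IsConnectedGrading

end Antipode

end SymbPolylog

open SymbPolylog in
theorem theorem2 :
    -- coassociativity
    (Algebra.TensorProduct.assoc ℚ ℚ ℚ HBar HBar HBar).toAlgHom.comp
        ((Algebra.TensorProduct.map comul (AlgHom.id ℚ HBar)).comp comul) =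
      (Algebra.TensorProduct.map (AlgHom.id ℚ HBar) comul).comp comul ∧
    -- the weight decomposition makes the algebra graded and connected
    DirectSum.IsInternal wt ∧ SetLike.GradedMonoid wt ∧
    wt 0 = LinearMap.range (Algebra.linearMap ℚ HBar) ∧
    -- the coproduct and the counit respect the weight
    (∀ n, ∀ x ∈ wt n, comul x ∈ wtTensor n) ∧
    (∀ n, n ≠ 0 → ∀ x ∈ wt n, counit x = 0) ∧
    -- they are part of a Hopf algebra structure whose antipode respects the weight
    ∃ H : HopfAlgebra ℚ HBar,
      (∃ hassoc hleft hright,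
        H.toBialgebra = Bialgebra.ofAlgHom comul counit hassoc hleft hright) ∧
      ∀ n, ∀ x ∈ wt n, H.antipode x ∈ wt n := by
  refine ⟨comul_coassoc, isInternal_wt, gradedMonoid_wt, wt_zero,
    fun n x hx => comul_mem_wtTensor hx, fun n hn x hx => counit_eq_zero hn hx, ?_⟩
  let B : Bialgebra ℚ HBar :=
    Bialgebra.ofAlgHom comul counit comul_coassoc rTensor_counit lTensor_counit
  let := MvPolynomial.weightedDecomposition ℚ Gen.weight
  -- `wtTensor` and `gradedTensor wt` unfold to the same supremum, so the weight statement for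
  -- `comul` applies directly.
  have h : IsConnectedGrading (K := ℚ) (A := HBar) wt :=
    { gradedMonoid := gradedMonoid_wt
      zero_eq := wt_zero
      comul_mem := fun n x hx => comul_mem_wtTensor hx
      counit_eq_zero := fun n hn x hx => counit_eq_zero hn hx }
  exact ⟨h.hopfAlgebra, ⟨comul_coassoc, rTensor_counit, lTensor_counit, rfl⟩,
    fun n x hx => h.antipode_mem hx⟩
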